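/- Let $\mathfrak G\subset \mathrm{GL}_2(\mathbb C)$ be the group (number 9 in the Shephard–Todd list, of order 192) generated by $$T=\tfrac1{\sqrt2}\begin{pmatrix}1&1\\1&-1\end{pmatrix},\qquad D=\begin{pmatrix}1&0\\0&i\end{pmatrix},$$ let $\mathfrak R=\mathbb C[x,y]^{\mathfrak G}=\{f : f(\sigma\mathbf x)=f(\mathbf x)\ \forall\sigma\in\mathfrak G\}$, $\mathbf x=(x,y)^{\mathsf T}$, and put $$\Gamma=-x^5y+xy^5,\qquad \Delta=x^{12}-33x^8y^4-33x^4y^8+y^{12}.$$ For a representation $\rho:\mathfrak G\to \mathrm{GL}_2(\mathbb C)$ let $$M(\rho)=\{F\in\mathbb C[x,y]^2 : F(\sigma\mathbf x)=\rho(\sigma)F(\mathbf x)\ \text{for all }\sigma\in\mathfrak G\},$$ a graded $\mathfrak R$-module, let $M(\rho)_d$ be the space of its elements both of whose entries are homogeneous of degree $d$, and let $\Phi_{M(\rho)}(t)=\sum_{d\ge0}\dim_{\mathbb C}M(\rho)_d\,t^d$. The two-dimensional irreducible representations $\rho_9,\dots,\rho_{20}$ of $\mathfrak G$ are the following. Put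 $\eta_9=\eta_{13}=1$, $\eta_{10}=\eta_{14}=i$, $\eta_{11}=\eta_{15}=-1$, $\eta_{12}=\eta_{16}=-i$. For $9\le i\le 12$, $\rho_i(T)=T$ and $\rho_i(D)=\eta_iD$; for $13\le i\le 16$, $\rho_i(T)=-T$ and $\rho_i(D)=\eta_iD$; and for $17\le i\le 20$, $$\rho_i(T)=\tfrac12\begin{pmatrix}1&3\\1&-1\end{pmatrix},\qquad \rho_i(D)=\eta_i\,\mathrm{diag}(1,-1),\qquad (\eta_{17},\eta_{18},\eta_{19},\eta_{20})=(-1,\,i,\,1,\,-i).$$ **Theorem.** For each $i=9,\dots,20$ the $\mathfrak R$-module $M(\rho_i)$ is free of rank $2$. There are homogeneous elements $\mathbf u_i^{(1)},\mathbf u_i^{(2)}\in M(\rho_i)$, of degrees $d_i^{(1)},d_i^{(2)}$, such that $$M(\rho_i)=\mathfrak R\,\mathbf u_i^{(1)}\oplus\mathfrak R\,\mathbf u_i^{(2)}\quad\text{(a basis)},\qquad \det\bigl[\mathbf u_i^{(1)}\ \mathbf u_i^{(2)}\bigr]=c_i\,\Delta\,\Gamma^{k_i},$$ with the values below. In particular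 $d_i^{(1)}+d_i^{(2)}=\deg\Delta+k_i\deg\Gamma=12+6k_i$. Moreover $$\Phi_{M(\rho_i)}(t)=\frac{t^{d_i^{(1)}}+t^{d_i^{(2)}}}{(1-t^8)(1-t^{24})},$$ and its expansion begins as listed (the next possibly nonzero term has degree $d_i^{(1)}+40$). $$\begin{array}{c|ccccl} i & c_i & k_i & d_i^{(1)} & d_i^{(2)} & \Phi_{M(\rho_i)}(t)\\ \hline 9&-1&1&1&17&t+t^{9}+2t^{17}+3t^{25}+3t^{33}+\cdots\\ 10&9&3&7&23&t^7+t^{15}+2t^{23}+3t^{31}+3t^{39}+\cdots\\ 11&-1&5&13&29&t^{13}+t^{21}+2t^{29}+3t^{37}+3t^{45}+\cdots\\ 12&176&3&11&19&t^{11}+2t^{19}+2t^{27}+3t^{35}+4t^{43}+\cdots\\ 13&4&1&5&13&t^5+2t^{13}+2t^{21}+3t^{29}+4t^{37}+\cdots\\ 14&6&3&11&19&t^{11}+2t^{19}+2t^{27}+3t^{35}+4t^{43}+\cdots\\ 15&-1&5&17&25&t^{17}+2t^{25}+2t^{33}+3t^{41}+4t^{49}+\cdots\\ 16&1773&3&7&23&t^7+t^{15}+2t^{23}+3t^{31}+3t^{39}+\cdots\\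 17&-411&2&8&16&t^8+2t^{16}+2t^{24}+3t^{32}+4t^{40}+\cdots\\ 18&-10&4&10&26&t^{10}+t^{18}+2t^{26}+3t^{34}+3t^{42}+\cdots\\ 19&1&2&4&20&t^4+t^{12}+2t^{20}+3t^{28}+3t^{36}+\cdots\\ 20&-1&4&14&22&t^{14}+2t^{22}+2t^{30}+3t^{38}+4t^{46}+\cdots \end{array}$$ -/

import Mathlib

open MvPolynomial

noncomputable section

namespace G9

/-! ### Covariants of a finite linear group -/

section General

variable {n m : ℕ}

/-- The substitution `f(x) ↦ f(g x)`, where `g x` is the product of the matrix `g` with the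
column vector of the variables. -/
def subst (g : Matrix (Fin n) (Fin n) ℂ) :
    MvPolynomial (Fin n) ℂ →ₐ[ℂ] MvPolynomial (Fin n) ℂ :=
  aeval fun j => ∑ k, C (g j k) * X k

/-- The ring of invariants `ℂ[x]^G`. -/
def invariants (G : Subgroup (GL (Fin n) ℂ)) : Subalgebra ℂ (MvPolynomial (Fin n) ℂ) where
  carrier := {f | ∀ g : G, subst (g : GL (Fin n) ℂ).val f = f}
  mul_mem' ha hb g := by rw [map_mul, ha g, hb g]
  add_mem' ha hb g := by rw [map_add, ha g, hb g]
  algebraMap_mem' r g := AlgHom.commutes _ r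

/-- The module `M(ρ)` of `ρ`-covariants: all vectors `F` of polynomials with
`F(g x) = ρ(g) F(x)` for all `g ∈ G`, as a module over the ring of invariants. -/
def covariants {G : Subgroup (GL (Fin n) ℂ)} (ρ : G →* GL (Fin m) ℂ) :
    Submodule (invariants G) (Fin m → MvPolynomial (Fin n) ℂ) where
  carrier := {F | ∀ (g : G) (a : Fin m),
    subst (g : GL (Fin n) ℂ).val (F a) = ∑ b, C ((ρ g).val a b) * F b}
  add_mem' hF hH g a := by
    simp only [Pi.add_apply, map_add, hF g a, hH g a, mul_add, Finset.sum_add_distrib]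
  zero_mem' g a := by simp
  smul_mem' r F hF g a := by
    have h1 : (r • F) a = (r : MvPolynomial (Fin n) ℂ) * F a := rfl
    have h2 : ∀ b, (r • F) b = (r : MvPolynomial (Fin n) ℂ) * F b := fun _ => rfl
    rw [h1, map_mul, hF g a, r.2 g, Finset.mul_sum]
    exact Finset.sum_congr rfl fun b _ => by rw [h2]; ring

/-- A vector of polynomials is homogeneous of degree `d` if all its entries are. -/
def IsHomogeneousVec (F : Fin m → MvPolynomial (Fin n) ℂ) (d : ℕ) : Prop :=
  ∀ a, (F a).IsHomogeneous d

/-- The complex vector space `M(ρ)_d` of the covariants that are homogeneous of degree `d`. -/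
def covariantsOfDegree {G : Subgroup (GL (Fin n) ℂ)} (ρ : G →* GL (Fin m) ℂ) (d : ℕ) :
    Submodule ℂ (Fin m → MvPolynomial (Fin n) ℂ) where
  carrier := {F | F ∈ covariants ρ ∧ IsHomogeneousVec F d}
  add_mem' hF hH := ⟨add_mem hF.1 hH.1, fun a => (hF.2 a).add (hH.2 a)⟩
  zero_mem' := ⟨zero_mem _, fun _ => isHomogeneous_zero _ _ _⟩
  smul_mem' c F hF := by
    refine ⟨?_, fun a => ?_⟩
    · have h : c • F = (algebraMap ℂ (invariants G) c) • F := by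
        rw [algebraMap_smul]
      rw [h]
      exact Submodule.smul_mem _ _ hF.1
    · rw [Pi.smul_apply, smul_eq_C_mul]
      simpa using (isHomogeneous_C (Fin n) c).mul (hF.2 a)

lemma finite_covariantsOfDegree {G : Subgroup (GL (Fin n) ℂ)} (ρ : G →* GL (Fin m) ℂ) (d : ℕ) :
    Module.Finite ℂ (covariantsOfDegree ρ d) := by
  have : Module.Finite ℂ (homogeneousSubmodule (Fin n) ℂ d) :=
    Module.Finite.iff_fg.2 (homogeneousSubmodule_fg (σ := Fin n) (R := ℂ) d)
  let f : covariantsOfDegree ρ d →ₗ[ℂ] (Fin m → homogeneousSubmodule (Fin n) ℂ d) :=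
    { toFun := fun F a => ⟨F.1 a, F.2.2 a⟩
      map_add' := fun _ _ => rfl
      map_smul' := fun _ _ => rfl }
  refine Module.Finite.of_injective f fun F H h => Subtype.ext (funext fun a => ?_)
  exact congrArg Subtype.val (congrFun h a)

/-- The Hilbert series `∑ dim M(ρ)_d t^d`. -/
def hilbertSeries {G : Subgroup (GL (Fin n) ℂ)} (ρ : G →* GL (Fin m) ℂ) : PowerSeries ℤ :=
  PowerSeries.mk fun d => (Module.finrank ℂ (covariantsOfDegree ρ d) : ℤ)

/-- The tensor product of a one-dimensional representation with `ρ`. -/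
def twist {G : Type*} [Group G] (χ : G →* ℂˣ) (ρ : G →* GL (Fin m) ℂ) : G →* GL (Fin m) ℂ where
  toFun g := χ g • ρ g
  map_one' := by simp
  map_mul' g h := by
    ext a b
    simp only [map_mul, Units.smul_def, Units.val_smul, Units.val_mul, Matrix.smul_mul,
      Matrix.mul_smul, Matrix.smul_apply, smul_eq_mul]
    ring

end General

/-! ### The group and its two-dimensional representations -/

/-- The matrix `T`. -/
def T : GL (Fin 2) ℂ :=
  Matrix.GeneralLinearGroup.mkOfDetNeZero (((√2 : ℝ) : ℂ)⁻¹ • !![1, 1; 1, -1]) (by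
    have h2 : ((√2 : ℝ) : ℂ) ≠ 0 := by simp
    have h : ∀ r : ℂ, r ≠ 0 → (r • !![(1 : ℂ), 1; 1, -1]).det ≠ 0 := by
      intro r hr h0
      rw [Matrix.det_smul, Matrix.det_fin_two_of] at h0
      norm_num [hr] at h0
    exact h _ (inv_ne_zero h2))

/-- The matrix `D`. -/
def D : GL (Fin 2) ℂ :=
  Matrix.GeneralLinearGroup.mkOfDetNeZero !![1, 0; 0, Complex.I] (by simp [Matrix.det_fin_two])

/-- The Shephard-Todd group number 9. -/
def group : Subgroup (GL (Fin 2) ℂ) := Subgroup.closure {T, D}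

/-- `T` as an element of the group. -/
def gT : group := ⟨T, Subgroup.subset_closure (by simp)⟩

/-- `D` as an element of the group. -/
def gD : group := ⟨D, Subgroup.subset_closure (by simp)⟩

lemma T_val : T.val = ((√2 : ℝ) : ℂ)⁻¹ • !![1, 1; 1, -1] := rfl

lemma D_val : D.val = !![1, 0; 0, Complex.I] := rfl

/-- The matrix `(1/2) (1 3; 1 -1)`. -/
def T₀ : GL (Fin 2) ℂ :=
  Matrix.GeneralLinearGroup.mkOfDetNeZero !![1/2, 3/2; 1/2, -1/2] (by
    simp [Matrix.det_fin_two]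
    norm_num)

/-- The matrix `diag(1, -1)`. -/
def D₀ : GL (Fin 2) ℂ :=
  Matrix.GeneralLinearGroup.mkOfDetNeZero !![1, 0; 0, -1] (by simp [Matrix.det_fin_two])

lemma T₀_val : T₀.val = !![1/2, 3/2; 1/2, -1/2] := rfl

lemma D₀_val : D₀.val = !![1, 0; 0, -1] := rfl

/-- An auxiliary covariant map, used only to see that `T ↦ T₀`, `D ↦ D₀` extends to the group. -/
def auxMap (v : Fin 2 → ℂ) : Fin 2 → ℂ := ![v 0 ^ 4 + v 1 ^ 4, 2 * v 0 ^ 2 * v 1 ^ 2]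

lemma auxMap_T (v : Fin 2 → ℂ) : auxMap (T.val.mulVec v) = T₀.val.mulVec (auxMap v) := by
  have h2 : (((√2 : ℝ) : ℂ)⁻¹) ^ 2 = 1 / 2 := by
    rw [inv_pow, ← Complex.ofReal_pow, Real.sq_sqrt (by norm_num)]; norm_num
  have h4 : (((√2 : ℝ) : ℂ)⁻¹) ^ 4 = 1 / 4 := by
    rw [show (4 : ℕ) = 2 * 2 from rfl, pow_mul, h2]; norm_num
  rw [T_val, T₀_val]
  ext i
  fin_cases i <;>
    simp only [auxMap, Matrix.mulVec, dotProduct, Fin.sum_univ_two, Matrix.smul_apply,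
      smul_eq_mul, Fin.zero_eta, Fin.mk_one, Matrix.of_apply, Matrix.cons_val_zero,
      Matrix.cons_val_one, Matrix.cons_val', Matrix.cons_val_fin_one]
  · linear_combination (2 * v 0 ^ 4 + 12 * v 0 ^ 2 * v 1 ^ 2 + 2 * v 1 ^ 4) * h4
  · linear_combination (2 * (v 0 ^ 2 - v 1 ^ 2) ^ 2) * h4

lemma auxMap_D (v : Fin 2 → ℂ) : auxMap (D.val.mulVec v) = D₀.val.mulVec (auxMap v) := by
  have h2 : Complex.I ^ 2 = -1 := Complex.I_sq
  have h4 : Complex.I ^ 4 = 1 := Complex.I_pow_four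
  rw [D_val, D₀_val]
  ext i
  fin_cases i <;>
    simp only [auxMap, Matrix.mulVec, dotProduct, Fin.sum_univ_two,
      Fin.zero_eta, Fin.mk_one, Matrix.of_apply, Matrix.cons_val_zero,
      Matrix.cons_val_one, Matrix.cons_val', Matrix.cons_val_fin_one]
  · linear_combination v 1 ^ 4 * h4
  · linear_combination 2 * v 0 ^ 2 * v 1 ^ 2 * h2

lemma auxMap_exists (g : GL (Fin 2) ℂ) (hg : g ∈ group) :
    ∃ B : GL (Fin 2) ℂ, ∀ v, auxMap (g.val.mulVec v) = B.val.mulVec (auxMap v) := by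
  induction hg using Subgroup.closure_induction with
  | mem x hx =>
    rcases hx with rfl | rfl
    · exact ⟨T₀, auxMap_T⟩
    · exact ⟨D₀, auxMap_D⟩
  | one => exact ⟨1, fun v => by simp⟩
  | mul x y _ _ hx hy =>
    obtain ⟨B, hB⟩ := hx
    obtain ⟨B', hB'⟩ := hy
    refine ⟨B * B', fun v => ?_⟩
    rw [Units.val_mul, Units.val_mul, ← Matrix.mulVec_mulVec, hB, hB', Matrix.mulVec_mulVec]
  | inv x _ hx =>
    obtain ⟨B, hB⟩ := hx
    refine ⟨B⁻¹, fun v => ?_⟩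
    have h := hB ((x⁻¹).val.mulVec v)
    rw [Matrix.mulVec_mulVec, ← Units.val_mul, mul_inv_cancel, Units.val_one,
      Matrix.one_mulVec] at h
    rw [h, Matrix.mulVec_mulVec, ← Units.val_mul, inv_mul_cancel, Units.val_one,
      Matrix.one_mulVec]

lemma auxMap_unique (B B' : GL (Fin 2) ℂ)
    (h : ∀ v, B.val.mulVec (auxMap v) = B'.val.mulVec (auxMap v)) : B = B' := by
  apply Units.ext
  have h1 := h ![1, 0]
  have h2 := h ![1, 1]
  have key : ∀ i, B.val i 0 = B'.val i 0 ∧ B.val i 1 = B'.val i 1 := by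
    intro i
    have e1 := congrFun h1 i
    have e2 := congrFun h2 i
    simp only [auxMap, Matrix.mulVec, dotProduct, Fin.sum_univ_two, Matrix.cons_val_zero,
      Matrix.cons_val_one, Matrix.cons_val_fin_one] at e1 e2
    norm_num at e1 e2
    refine ⟨e1, ?_⟩
    linear_combination (e2 - 2 * e1) / 2
  ext i j
  fin_cases j
  · exact (key i).1
  · exact (key i).2

lemma exists_rhoZero : ∃ ρ : group →* GL (Fin 2) ℂ, ρ gT = T₀ ∧ ρ gD = D₀ := by
  choose f hf using fun g : group => auxMap_exists g.1 g.2
  refine ⟨MonoidHom.mk' f fun g h => auxMap_unique _ _ fun v => ?_, ?_, ?_⟩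
  · rw [← hf, Units.val_mul, ← Matrix.mulVec_mulVec, ← hf, ← hf, Matrix.mulVec_mulVec,
      ← Units.val_mul]
    rfl
  · exact auxMap_unique _ _ fun v => by rw [← auxMap_T]; exact (hf gT v).symm
  · exact auxMap_unique _ _ fun v => by rw [← auxMap_D]; exact (hf gD v).symm

/-- The representation with `T ↦ (1/2) (1 3; 1 -1)` and `D ↦ diag(1, -1)`. It is unique since
`T` and `D` generate the group. -/
def rhoZero : group →* GL (Fin 2) ℂ := exists_rhoZero.choose

/-- The natural representation. -/
def natRep : group →* GL (Fin 2) ℂ := group.subtype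

/-- The one-dimensional representation with `T ↦ -1`, `D ↦ -1`. -/
def chi₆ : group →* ℂˣ := Matrix.GeneralLinearGroup.det.comp rhoZero

/-- The determinant representation, `T ↦ -1`, `D ↦ i`. -/
def chi₇ : group →* ℂˣ := Matrix.GeneralLinearGroup.det.comp natRep

/-- The two-dimensional representations `ρ₉, …, ρ₂₀` (other indices are not used); see
`rho_gT` and `rho_gD` for their values on the generators. -/
def rho : ℕ → (group →* GL (Fin 2) ℂ)
  | 9 => natRep
  | 10 => twist (chi₆ * chi₇ ^ 3) natRep
  | 11 => twist (chi₇ ^ 2) natRep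
  | 12 => twist (chi₆ * chi₇) natRep
  | 13 => twist (chi₆ * chi₇ ^ 2) natRep
  | 14 => twist chi₇ natRep
  | 15 => twist chi₆ natRep
  | 16 => twist (chi₇ ^ 3) natRep
  | 17 => twist (chi₇ ^ 2) rhoZero
  | 18 => twist (chi₆ * chi₇ ^ 3) rhoZero
  | 19 => rhoZero
  | 20 => twist (chi₆ * chi₇) rhoZero
  | _ => 1

/-- The matrices `ρᵢ(T)`. -/
def rhoT : ℕ → Matrix (Fin 2) (Fin 2) ℂ
  | 9 | 10 | 11 | 12 => T.val
  | 13 | 14 | 15 | 16 => -T.val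
  | 17 | 18 | 19 | 20 => !![1/2, 3/2; 1/2, -1/2]
  | _ => 1

/-- The matrices `ρᵢ(D)`. -/
def rhoD : ℕ → Matrix (Fin 2) (Fin 2) ℂ
  | 9 | 13 => !![1, 0; 0, Complex.I]
  | 10 | 14 => !![Complex.I, 0; 0, -1]
  | 11 | 15 => !![-1, 0; 0, -Complex.I]
  | 12 | 16 => !![-Complex.I, 0; 0, 1]
  | 17 => !![-1, 0; 0, 1]
  | 18 => !![Complex.I, 0; 0, -Complex.I]
  | 19 => !![1, 0; 0, -1]
  | 20 => !![-Complex.I, 0; 0, Complex.I]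
  | _ => 1

lemma rhoZero_gT : rhoZero gT = T₀ := exists_rhoZero.choose_spec.1

lemma rhoZero_gD : rhoZero gD = D₀ := exists_rhoZero.choose_spec.2

lemma chi₆_gT : chi₆ gT = -1 := by
  ext
  simp [chi₆, rhoZero_gT, Matrix.GeneralLinearGroup.det, T₀_val, Matrix.det_fin_two]
  norm_num

lemma chi₆_gD : chi₆ gD = -1 := by
  ext
  simp [chi₆, rhoZero_gD, Matrix.GeneralLinearGroup.det, D₀_val, Matrix.det_fin_two]

lemma chi₇_gT : chi₇ gT = -1 := by
  have h2 : (((√2 : ℝ) : ℂ)⁻¹) ^ 2 = 1 / 2 := by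
    rw [inv_pow, ← Complex.ofReal_pow, Real.sq_sqrt (by norm_num)]; norm_num
  ext
  simp only [chi₇, MonoidHom.comp_apply, natRep, Subgroup.subtype_apply, gT,
    Matrix.GeneralLinearGroup.val_det_apply, T_val, Matrix.det_fin_two, Matrix.smul_apply,
    smul_eq_mul, Matrix.of_apply, Matrix.cons_val_zero, Matrix.cons_val_one, Matrix.cons_val',
    Matrix.cons_val_fin_one, Units.val_neg, Units.val_one]
  linear_combination (-2) * h2

lemma chi₇_gD : (chi₇ gD).val = Complex.I := by
  simp [chi₇, natRep, gD, D_val, Matrix.det_fin_two]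

/-- The values of the representations on `T`. -/
lemma rho_gT (i : ℕ) : (rho i gT).val = rhoT i := by
  have hn : (natRep gT).val = T.val := rfl
  have h3 : (-1 : ℂ) ^ 3 = -1 := by norm_num
  unfold rho rhoT
  split <;>
    simp [twist, Units.val_smul, chi₆_gT, chi₇_gT, rhoZero_gT, T₀_val, hn, Units.smul_def, h3]

/-- The values of the representations on `D`. -/
lemma rho_gD (i : ℕ) : (rho i gD).val = rhoD i := by
  have hn : (natRep gD).val = !![1, 0; 0, Complex.I] := rfl
  have h2 : Complex.I ^ 2 = -1 := Complex.I_sq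
  have h3 : Complex.I ^ 3 = -Complex.I := Complex.I_pow_three
  unfold rho rhoD
  split <;>
    simp [twist, Units.val_smul, chi₆_gD, chi₇_gD, rhoZero_gD, D₀_val, hn, Units.smul_def,
      Matrix.smul_of, h2, h3]

/-! ### The octahedral invariants and the numerical data -/

/-- `Γ = -x⁵y + xy⁵`. -/
def Gam : MvPolynomial (Fin 2) ℂ := -X 0 ^ 5 * X 1 + X 0 * X 1 ^ 5

/-- `Δ = x¹² - 33x⁸y⁴ - 33x⁴y⁸ + y¹²`. -/
def Del : MvPolynomial (Fin 2) ℂ :=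
  X 0 ^ 12 - 33 * X 0 ^ 8 * X 1 ^ 4 - 33 * X 0 ^ 4 * X 1 ^ 8 + X 1 ^ 12

/-- The constants `cᵢ`. -/
def cConst : ℕ → ℤ
  | 9 => -1
  | 10 => 9
  | 11 => -1
  | 12 => 176
  | 13 => 4
  | 14 => 6
  | 15 => -1
  | 16 => 1773
  | 17 => -411
  | 18 => -10
  | 19 => 1
  | 20 => -1
  | _ => 0

/-- The exponents `kᵢ`. -/
def kExp : ℕ → ℕ
  | 9 => 1
  | 10 => 3
  | 11 => 5
  | 12 => 3
  | 13 => 1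
  | 14 => 3
  | 15 => 5
  | 16 => 3
  | 17 => 2
  | 18 => 4
  | 19 => 2
  | 20 => 4
  | _ => 0

/-- The degrees of the first generators. -/
def deg₁ : ℕ → ℕ
  | 9 => 1
  | 10 => 7
  | 11 => 13
  | 12 => 11
  | 13 => 5
  | 14 => 11
  | 15 => 17
  | 16 => 7
  | 17 => 8
  | 18 => 10
  | 19 => 4
  | 20 => 14
  | _ => 0

/-- The degrees of the second generators. -/
def deg₂ : ℕ → ℕ
  | 9 => 17
  | 10 => 23
  | 11 => 29
  | 12 => 19
  | 13 => 13
  | 14 => 19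
  | 15 => 25
  | 16 => 23
  | 17 => 16
  | 18 => 26
  | 19 => 20
  | 20 => 22
  | _ => 0

/-- The coefficients of `t^(d + 8j)`, `j = 0, …, 4`, in the Hilbert series, where `d` is the degree
of the first generator. -/
def seriesCoeff : ℕ → Fin 5 → ℕ
  | 9 | 10 | 11 | 16 | 18 | 19 => ![1, 1, 2, 3, 3]
  | 12 | 13 | 14 | 15 | 17 | 20 => ![1, 2, 2, 3, 4]
  | _ => 0

end G9

end

namespace G9

/-! ### Linear substitutions and covariants for an arbitrary group -/

section General

variable {n m : ℕ}

/-! The proof is a determinant criterion. For covariants F, H of type ρ, the bracket det[F H] is a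
semi-invariant with character det ρ. It changes sign under the reflection T, so it vanishes on the
mirrors conjugate to that of T, whose product is Δ up to a constant. Under D the two entries of a
covariant have eigenvalues i^a and i^b with 0 ≤ a, b < 4, so they are divisible by y^a and y^b. The
bracket is then divisible by y^(a+b), and along the orbit of the line y = 0 by Γ^(a+b), where a + b
= k. Hence ΔΓ^k divides every bracket (`Del_mul_Gam_pow_dvd_bracket`).

If some pair u, v attains det[u v] = cΔΓ^k with c ≠ 0, Cramer's rule writes each F as (det[F v] u +
det[u F] v) / det[u v]. The quotients are polynomials, and they are invariant because numerator and
denominator have the same character. So u, v is a basis (`exists_coordinates`, `exists_basis`).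

Such pairs come from six basic covariants, paired so that their bracket is a constant times a power
of Γ. Multiplying both members by Γ^m, and one of them also by Δ, reaches all twelve representations
(`exists_generators_of_isCovariant`).

Cramer's rule respects degrees, so the Hilbert series reduces to that of the invariants. There,
reading off the coefficient of x^d has kernel Γ⁴ times the invariants of degree d - 24, and image ℂ
or 0 according to whether 8 divides d (`finrank_invariantsOfDegree_zero`). -/

lemma subst_X (g : Matrix (Fin n) (Fin n) ℂ) (j : Fin n) :
    subst g (X j) = ∑ k, C (g j k) * X k := by simp [subst]

lemma subst_C (g : Matrix (Fin n) (Fin n) ℂ) (c : ℂ) : subst g (C c) = C c := by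
  simp [subst]

lemma subst_one (f : MvPolynomial (Fin n) ℂ) : subst 1 f = f := by
  have h : subst (1 : Matrix (Fin n) (Fin n) ℂ) = AlgHom.id ℂ _ := by
    ext j : 1
    simp [subst_X, Matrix.one_apply]
  rw [h, AlgHom.id_apply]

/-- The order reverses: f(ghx) arises from f by inserting gx first, and then hx for x. -/
lemma subst_mul (g h : Matrix (Fin n) (Fin n) ℂ) (f : MvPolynomial (Fin n) ℂ) :
    subst (g * h) f = subst h (subst g f) := by
  have e : subst (g * h) = (subst h).comp (subst g) := by
    ext j : 1
    simp only [AlgHom.comp_apply, subst_X, map_sum, map_mul, subst_C, Matrix.mul_apply,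
      Finset.sum_mul, Finset.mul_sum]
    rw [Finset.sum_comm]
    exact Finset.sum_congr rfl fun k _ => Finset.sum_congr rfl fun l _ => by ring
  rw [e, AlgHom.comp_apply]

/-- Covariance has to be checked on generators of the group only. -/
lemma mem_covariants_of_closure {G : Subgroup (GL (Fin n) ℂ)} {S : Set (GL (Fin n) ℂ)}
    (hG : G = Subgroup.closure S) (ρ : G →* GL (Fin m) ℂ) (F : Fin m → MvPolynomial (Fin n) ℂ)
    (h : ∀ g : G, (g : GL (Fin n) ℂ) ∈ S → ∀ a : Fin m,
      subst (g : GL (Fin n) ℂ).val (F a) = ∑ b, C ((ρ g).val a b) * F b) :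
    F ∈ covariants ρ := by
  subst hG
  rintro ⟨g, hg⟩
  induction hg using Subgroup.closure_induction with
  | mem x hx => exact h ⟨x, Subgroup.subset_closure hx⟩ hx
  | one =>
    intro a
    have h1 : ρ ⟨1, one_mem _⟩ = 1 := map_one ρ
    simp [h1, subst_one, Matrix.one_apply]
  | mul x y hx hy hFx hFy =>
    intro a
    have h1 : ρ ⟨x * y, mul_mem hx hy⟩ = ρ ⟨x, hx⟩ * ρ ⟨y, hy⟩ := map_mul ρ ⟨x, hx⟩ ⟨y, hy⟩
    rw [h1]
    simp only [Units.val_mul, subst_mul, hFx, map_sum, map_mul, subst_C, hFy, Matrix.mul_apply,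
      Finset.sum_mul, Finset.mul_sum]
    rw [Finset.sum_comm]
    exact Finset.sum_congr rfl fun k _ => Finset.sum_congr rfl fun l _ => by ring
  | inv x hx hFx =>
    intro a
    have h1 : ρ ⟨x⁻¹, inv_mem hx⟩ = (ρ ⟨x, hx⟩)⁻¹ := map_inv ρ ⟨x, hx⟩
    -- Inserting x⁻¹ into the covariance under x expresses F as ρ(x) applied to the substituted
    -- vector; it remains to multiply by ρ(x)⁻¹.
    have h2 : ∀ b, F b = ∑ c, C ((ρ ⟨x, hx⟩).val b c) * subst (x⁻¹).val (F c) := by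
      intro b
      have h3 := congrArg (subst (x⁻¹).val) (hFx b)
      rw [← subst_mul, ← Units.val_mul, mul_inv_cancel, Units.val_one, subst_one] at h3
      simpa [subst_C] using h3
    have h4 : ((ρ ⟨x, hx⟩)⁻¹).val * (ρ ⟨x, hx⟩).val = 1 := by
      rw [← Units.val_mul, inv_mul_cancel, Units.val_one]
    have h5 : ∑ b, C (((ρ ⟨x, hx⟩)⁻¹).val a b) *
        ∑ c, C ((ρ ⟨x, hx⟩).val b c) * subst (x⁻¹).val (F c) = subst (x⁻¹).val (F a) := by
      simp only [Finset.mul_sum]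
      rw [Finset.sum_comm]
      simp only [← mul_assoc, ← Finset.sum_mul, ← C_mul, ← map_sum, ← Matrix.mul_apply, h4]
      simp [Matrix.one_apply]
    rw [h1]
    simp only [← h2] at h5
    exact h5.symm

/-- Monomials are eigenvectors of diagonal substitutions. This serves three times: for D, for the
dilation by 2 that detects homogeneity, and for the scalar matrix (TD)³. -/
lemma coeff_subst_diagonal (d : Fin n → ℂ) (f : MvPolynomial (Fin n) ℂ) (s : Fin n →₀ ℕ) :
    coeff s (subst (Matrix.diagonal d) f) = (∏ j, d j ^ s j) * coeff s f := by
  induction f using MvPolynomial.induction_on' with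
  | add p q hp hq => rw [map_add, coeff_add, coeff_add, hp, hq, mul_add]
  | monomial u a =>
    have h : subst (Matrix.diagonal d) (monomial u a) = C (∏ j, d j ^ u j) * monomial u a := by
      have hX : ∀ j, subst (Matrix.diagonal d) (X j) = C (d j) * X j := by
        intro j
        rw [subst_X, Finset.sum_eq_single j]
        · simp
        · intro k _ hk
          simp [Matrix.diagonal_apply_ne _ hk.symm]
        · simp
      rw [monomial_eq, Finsupp.prod_fintype _ _ (by simp)]
      simp only [map_mul, map_prod, map_pow, subst_C, hX, mul_pow, Finset.prod_mul_distrib]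
      ring
    rw [h, coeff_C_mul, coeff_monomial]
    split_ifs with e
    · rw [e]
    · simp

/-- A polynomial that is scaled by `2 ^ d` is homogeneous of degree `d`. -/
lemma isHomogeneous_of_subst_two {f : MvPolynomial (Fin n) ℂ} {d e : ℕ}
    (h : C (2 ^ e) * subst (Matrix.diagonal fun _ => 2) f = C (2 ^ d) * f)
    (s : Fin n →₀ ℕ) (hs : coeff s f ≠ 0) : s.degree + e = d := by
  have h1 := congrArg (coeff s) h
  rw [coeff_C_mul, coeff_C_mul, coeff_subst_diagonal, Finset.prod_pow_eq_pow_sum, ← mul_assoc,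
    ← pow_add] at h1
  have h2 := mul_right_cancel₀ hs h1
  -- The degree is d - e; the additive form avoids truncated subtraction and forces f = 0 when d <
  -- e.
  have h3 : e + ∑ i, s i = d := by
    have h4 : (2 : ℕ) ^ (e + ∑ i, s i) = 2 ^ d := by exact_mod_cast h2
    exact Nat.pow_right_injective le_rfl h4
  rw [Finsupp.degree_eq_sum]
  omega

lemma subst_two_of_isHomogeneous {f : MvPolynomial (Fin n) ℂ} {d : ℕ} (hf : f.IsHomogeneous d) :
    subst (Matrix.diagonal fun _ => 2) f = C (2 ^ d) * f := by
  ext s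
  rw [coeff_subst_diagonal, coeff_C_mul, Finset.prod_pow_eq_pow_sum]
  by_cases hs : coeff s f = 0
  · simp [hs]
  · have h := hf hs
    rw [← h]
    congr 2
    simp [Finsupp.weight_apply, Finsupp.sum_fintype]

end General

/-! ### Semi-invariants of the group -/

lemma mem_covariants_rho {i : ℕ} {F : Fin 2 → MvPolynomial (Fin 2) ℂ}
    (hT : ∀ a, subst T.val (F a) = ∑ b, C (rhoT i a b) * F b)
    (hD : ∀ a, subst D.val (F a) = ∑ b, C (rhoD i a b) * F b) : F ∈ covariants (rho i) := by
  refine mem_covariants_of_closure (G := group) (S := {T, D}) rfl (rho i) F ?_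
  rintro g (hg | hg) a
  · rw [show g = gT from Subtype.ext hg, rho_gT]
    exact hT a
  · rw [show g = gD from Subtype.ext hg, rho_gD]
    exact hD a

lemma subst_T_of_mem {i : ℕ} {F : Fin 2 → MvPolynomial (Fin 2) ℂ} (h : F ∈ covariants (rho i))
    (a : Fin 2) : subst T.val (F a) = ∑ b, C (rhoT i a b) * F b := by
  rw [← rho_gT]
  exact h gT a

lemma subst_D_of_mem {i : ℕ} {F : Fin 2 → MvPolynomial (Fin 2) ℂ} (h : F ∈ covariants (rho i))
    (a : Fin 2) : subst D.val (F a) = ∑ b, C (rhoD i a b) * F b := by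
  rw [← rho_gD]
  exact h gD a

lemma mem_invariants {f : MvPolynomial (Fin 2) ℂ} (hT : subst T.val f = f)
    (hD : subst D.val f = f) : f ∈ invariants group := by
  -- An invariant is a covariant of the trivial one-dimensional representation, so generators
  -- suffice here too.
  have h : (fun _ : Fin 1 => f) ∈ covariants (1 : group →* GL (Fin 1) ℂ) := by
    refine mem_covariants_of_closure (G := group) (S := {T, D}) rfl 1 _ ?_
    rintro g (hg | hg) a
    · simp [show (g : GL (Fin 2) ℂ) = T from hg, hT, Subsingleton.elim a 0]
    · simp [show (g : GL (Fin 2) ℂ) = D from hg, hD, Subsingleton.elim a 0]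
  intro g
  simpa [Matrix.one_apply] using h g 0

lemma subst_T_of_mem_invariants {f : MvPolynomial (Fin 2) ℂ} (h : f ∈ invariants group) :
    subst T.val f = f := h gT

lemma subst_D_of_mem_invariants {f : MvPolynomial (Fin 2) ℂ} (h : f ∈ invariants group) :
    subst D.val f = f := h gD

/-- The number `1/√2`. -/
noncomputable def rt : ℂ := ((√2 : ℝ) : ℂ)⁻¹

lemma rt_sq : rt ^ 2 = 1 / 2 := by
  rw [rt, inv_pow, ← Complex.ofReal_pow, Real.sq_sqrt (by norm_num)]; norm_num

lemma rt_ne_zero : rt ≠ 0 := by simp [rt]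

lemma subst_T_X0 : subst T.val (X 0) = C rt * (X 0 + X 1) := by
  simp [subst_X, T_val, rt, mul_add]

lemma subst_T_X1 : subst T.val (X 1) = C rt * (X 0 - X 1) := by
  simp [subst_X, T_val, rt, mul_add, sub_eq_add_neg]

lemma subst_D_X0 : subst D.val (X 0) = X 0 := by
  simp [subst_X, D_val]

lemma subst_D_X1 : subst D.val (X 1) = C Complex.I * X 1 := by
  simp [subst_X, D_val]

lemma D_val_eq_diagonal : D.val = Matrix.diagonal ![1, Complex.I] := by
  rw [D_val]
  ext a b
  fin_cases a <;> fin_cases b <;> simp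

lemma coeff_subst_D (f : MvPolynomial (Fin 2) ℂ) (s : Fin 2 →₀ ℕ) :
    coeff s (subst D.val f) = Complex.I ^ s 1 * coeff s f := by
  rw [D_val_eq_diagonal, coeff_subst_diagonal]
  simp [Fin.prod_univ_two]

lemma C_rt_sq : (C rt : MvPolynomial (Fin 2) ℂ) ^ 2 * 2 = 1 := by
  have h : (2 : MvPolynomial (Fin 2) ℂ) = C 2 := (map_ofNat C 2).symm
  rw [h, ← C_pow, ← C_mul, rt_sq, ← C_1]
  congr 1
  norm_num

lemma C_I_sq : (C Complex.I : MvPolynomial (Fin 2) ℂ) ^ 2 = -1 := by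
  rw [← C_pow, Complex.I_sq, C_neg, C_1]

lemma C_I_pow_four : (C Complex.I : MvPolynomial (Fin 2) ℂ) ^ 4 = 1 := by
  rw [← C_pow, Complex.I_pow_four, C_1]

/-! ### Divisibility of determinants of covariants -/

lemma X_pow_dvd_of_coeff {σ R : Type*} [CommSemiring R] {i : σ} {e : ℕ} {f : MvPolynomial σ R}
    (h : ∀ s, coeff s f ≠ 0 → e ≤ s i) : X i ^ e ∣ f := by
  classical
  rw [X_pow_eq_monomial, monomial_one_dvd_iff_modMonomial_eq_zero]
  ext s
  rw [coeff_zero]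
  by_cases hs : Finsupp.single i e ≤ s
  · exact coeff_modMonomial_of_le _ hs
  · rw [coeff_modMonomial_of_not_le _ hs]
    by_contra h0
    exact hs (Finsupp.single_le_iff.2 (h s h0))

/-- D multiplies a monomial with y-exponent j by i^j, so only j ≡ e mod 4 occur, and e < 4 is the
least such exponent. -/
lemma X1_pow_dvd_of_subst_D {f : MvPolynomial (Fin 2) ℂ} {e : ℕ} (he : e < 4)
    (h : subst D.val f = C (Complex.I ^ e) * f) : X 1 ^ e ∣ f := by
  refine X_pow_dvd_of_coeff fun s hs => ?_
  have h1 := congrArg (coeff s) h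
  rw [coeff_subst_D, coeff_C_mul] at h1
  have h2 := mul_right_cancel₀ hs h1
  by_contra! hlt
  generalize s 1 = j at h2 hlt
  interval_cases e <;> interval_cases j <;> norm_num [Complex.ext_iff, pow_succ] at h2

/-- The binary form `xⁿ - a yⁿ`. -/
noncomputable def binom (n : ℕ) (a : ℂ) : MvPolynomial (Fin 2) ℂ := X 0 ^ n - C a * X 1 ^ n

lemma isRelPrime_X_pow (k l : ℕ) :
    IsRelPrime (X 0 ^ k : MvPolynomial (Fin 2) ℂ) (X 1 ^ l) := by
  have h : IsRelPrime (X 0 : MvPolynomial (Fin 2) ℂ) (X 1) := by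
    rw [(X_prime (R := ℂ) (i := (0 : Fin 2))).irreducible.isRelPrime_iff_not_dvd, X_dvd_X]
    simp
  exact h.pow

/-- A common divisor divides the difference, a nonzero multiple of yⁿ, and then also xⁿ. -/
lemma isRelPrime_binom {n : ℕ} {a b : ℂ} (hab : a ≠ b) :
    IsRelPrime (binom n a) (binom n b) := by
  intro d ha hb
  have h0 : C (a - b)⁻¹ * C (a - b) = (1 : MvPolynomial (Fin 2) ℂ) := by
    rw [← C_mul, inv_mul_cancel₀ (sub_ne_zero.2 hab), C_1]
  have h1 : d ∣ X 1 ^ n := by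
    have h := (dvd_sub hb ha).mul_left (C (a - b)⁻¹)
    have e : C (a - b)⁻¹ * (binom n b - binom n a) = X 1 ^ n := by
      rw [C_sub] at h0
      rw [binom, binom]
      linear_combination X 1 ^ n * h0
    rwa [e] at h
  have h2 : d ∣ X 0 ^ n := by
    have h := dvd_add ha (h1.mul_left (C a))
    rwa [binom, sub_add_cancel] at h
  exact isRelPrime_X_pow n n h2 h1

lemma isRelPrime_binom_X1 (n : ℕ) (a : ℂ) (hn : n ≠ 0) : IsRelPrime (binom n a) (X 1) := by
  intro d ha h1
  have h2 : d ∣ X 0 ^ n := by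
    have h := dvd_add ha ((h1.trans (dvd_pow_self _ hn)).mul_left (C a))
    rwa [binom, sub_add_cancel] at h
  exact isRelPrime_X_pow n 1 h2 (by simpa using h1)

lemma isRelPrime_binom_X0 (n : ℕ) {a : ℂ} (ha0 : a ≠ 0) (hn : n ≠ 0) :
    IsRelPrime (binom n a) (X 0) := by
  intro d ha h1
  have h2 : d ∣ X 1 ^ n := by
    have h := (dvd_sub (h1.trans (dvd_pow_self _ hn)) ha).mul_left (C a⁻¹)
    have e : C a⁻¹ * (X 0 ^ n - binom n a) = X 1 ^ n := by
      have h0 : C a⁻¹ * C a = (1 : MvPolynomial (Fin 2) ℂ) := by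
        rw [← C_mul, inv_mul_cancel₀ ha0, C_1]
      rw [binom]
      linear_combination X 1 ^ n * h0
    rwa [e] at h
  exact isRelPrime_X_pow 1 n (by simpa using h1) h2

/-! ### Moving factors of a semi-invariant along the group -/

section Orbit

variable {f : MvPolynomial (Fin 2) ℂ} {k : ℕ}

/-- Since g fixes f up to a unit, it carries divisors of f to divisors of f. -/
lemma dvd_of_subst {g : Matrix (Fin 2) (Fin 2) ℂ} {α β : ℂ} {p q : MvPolynomial (Fin 2) ℂ}
    (hf : subst g f = C α * f) (hα : α ≠ 0) (hpq : subst g p = C β * q)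
    (h : p ^ k ∣ f) : q ^ k ∣ f := by
  have h1 : subst g (p ^ k) ∣ subst g f := map_dvd _ h
  rw [hf, map_pow, hpq, mul_pow] at h1
  have h2 := ((Dvd.intro_left _ rfl).trans h1).mul_left (C α⁻¹)
  rwa [← mul_assoc, ← C_mul, inv_mul_cancel₀ hα, C_1, one_mul] at h2

/-- D sends x - by to x - biy. The four images of x - cy are pairwise coprime and multiply to x⁴ -
c⁴y⁴. -/
lemma binom_pow_dvd_of_subst_D {α : ℂ} (hD : subst D.val f = C α * f) (hα : α ≠ 0) {c : ℂ}
    (hc : c ≠ 0) (h : binom 1 c ^ k ∣ f) : binom 4 (c ^ 4) ^ k ∣ f := by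
  have step : ∀ b : ℂ, binom 1 b ^ k ∣ f → binom 1 (b * Complex.I) ^ k ∣ f := fun b hb =>
    dvd_of_subst hD hα (β := 1) (by
      simp only [binom, map_sub, map_mul, subst_C, pow_one, subst_D_X0, subst_D_X1, C_1]
      ring) hb
  have h1 := step _ h
  have h2 := step _ h1
  rw [mul_assoc, Complex.I_mul_I, mul_neg_one] at h2
  have h3 := step _ h2
  rw [neg_mul] at h3
  have e : binom 4 (c ^ 4) = binom 1 c * binom 1 (c * Complex.I) *
      binom 1 (-c) * binom 1 (-(c * Complex.I)) := by
    simp only [binom, C_mul, C_pow, pow_one, C_neg]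
    linear_combination (X 0 ^ 2 - C c ^ 2 * X 1 ^ 2) * C c ^ 2 * X 1 ^ 2 * C_I_sq
  have hI1 : Complex.I ≠ 1 := fun h => by simpa using congrArg Complex.re h
  have hI2 : Complex.I ≠ -1 := fun h => by simpa using congrArg Complex.re h
  rw [e, mul_pow, mul_pow, mul_pow]
  refine IsRelPrime.mul_dvd (IsRelPrime.mul_left (IsRelPrime.mul_left ?_ ?_) ?_)
    (IsRelPrime.mul_dvd (IsRelPrime.mul_left ?_ ?_) (IsRelPrime.mul_dvd ?_ h h1) h2) h3
  all_goals refine (isRelPrime_binom fun h => ?_).pow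
  all_goals
    first
    | exact hI1 (mul_left_cancel₀ hc (by linear_combination h))
    | exact hI1 (mul_left_cancel₀ hc (by linear_combination -h))
    | exact hI2 (mul_left_cancel₀ hc (by linear_combination h))
    | exact hI2 (mul_left_cancel₀ hc (by linear_combination -h))
    | exact hc (by linear_combination h / 2)
    | exact Complex.I_ne_zero (mul_left_cancel₀ hc (by linear_combination h / 2))

/-- On the parameter c of the line x = cy, T acts by the Möbius map c ↦ (c + 1)/(c - 1). -/
lemma binom_pow_dvd_of_subst_T {α : ℂ} (hT : subst T.val f = C α * f) (hα : α ≠ 0) {c d : ℂ}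
    (hd : d * (c - 1) = c + 1) (h : binom 1 c ^ k ∣ f) : binom 1 d ^ k ∣ f := by
  refine dvd_of_subst hT hα (β := rt * (1 - c)) ?_ h
  have hd' := congrArg (C (σ := Fin 2)) hd
  simp only [C_mul, C_sub, C_add, C_1] at hd'
  simp only [binom, map_sub, map_mul, subst_C, pow_one, subst_T_X0, subst_T_X1, C_1]
  linear_combination -(C rt * X 1) * hd'

/-- A polynomial changing sign under the reflection `T` vanishes on its mirror. -/
lemma binom_dvd_of_subst_T (hT : subst T.val f = -f) : binom 1 (1 + 2 * rt) ∣ f := by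
  set I : Ideal (MvPolynomial (Fin 2) ℂ) := Ideal.span {binom 1 (1 + 2 * rt)} with hI
  -- The mirror is x = (1 + √2)y, and 2·`rt` = √2. Modulo its equation T fixes both variables, hence
  -- every polynomial, so f ≡ -f.
  have h2 : (C 2 : MvPolynomial (Fin 2) ℂ) = 2 := map_ofNat C 2
  have e : (Ideal.Quotient.mkₐ ℂ I).comp (subst T.val) = Ideal.Quotient.mkₐ ℂ I := by
    ext j : 1
    rw [AlgHom.comp_apply, Ideal.Quotient.mkₐ_eq_mk, Ideal.Quotient.eq, hI,
      Ideal.mem_span_singleton]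
    fin_cases j
    · refine ⟨C (rt - 1), ?_⟩
      simp only [Fin.zero_eta, subst_T_X0, binom, C_sub, C_add, C_mul, C_1, h2]
      linear_combination X 1 * C_rt_sq
    · refine ⟨C rt, ?_⟩
      simp only [Fin.mk_one, subst_T_X1, binom, C_add, C_mul, C_1, h2]
      linear_combination X 1 * C_rt_sq
  have h := DFunLike.congr_fun e f
  rw [AlgHom.comp_apply, hT, Ideal.Quotient.mkₐ_eq_mk, Ideal.Quotient.eq, hI,
    Ideal.mem_span_singleton] at h
  have h3 := h.mul_left (C (-(1 / 2)))
  have e3 : C (-(1 / 2)) * (-f - f) = f := by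
    have h4 : C (1 / 2) * 2 = (1 : MvPolynomial (Fin 2) ℂ) := by
      rw [← h2, ← C_mul, ← C_1]
      norm_num
    rw [C_neg]
    linear_combination f * h4
  rwa [e3] at h3

end Orbit

/-! ### The lines of Γ and Δ -/

lemma one_add_two_rt_pow_four : (1 + 2 * rt) ^ 4 = 17 + 24 * rt := by
  linear_combination (32 + 32 * rt + 16 * rt ^ 2) * rt_sq

lemma two_rt_sub_one_pow_four : (2 * rt - 1) ^ 4 = 17 - 24 * rt := by
  linear_combination (32 - 32 * rt + 16 * rt ^ 2) * rt_sq

lemma Gam_eq : Gam = C (-1) * (binom 4 1 * X 0 * X 1) := by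
  simp only [Gam, binom, C_neg, C_1]
  ring

/-- The six lines of Γ form one orbit: T takes y to x - y, powers of D spread this to x⁴ - y⁴, and T
takes its factor x + y to x, up to constants. -/
lemma Gam_factors_pow_dvd {f : MvPolynomial (Fin 2) ℂ} {k : ℕ} {α β : ℂ} (hα : α ≠ 0) (hβ : β ≠ 0)
    (hT : subst T.val f = C α * f) (hD : subst D.val f = C β * f) (hk : X 1 ^ k ∣ f) :
    binom 4 1 ^ k ∣ f ∧ X 0 ^ k ∣ f := by
  have g1 : binom 1 1 ^ k ∣ f := by
    refine dvd_of_subst hT hα (β := rt) ?_ hk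
    rw [subst_T_X1, binom, C_1]
    ring
  have g2 : binom 4 1 ^ k ∣ f := by
    simpa using binom_pow_dvd_of_subst_D hD hβ one_ne_zero g1
  have g3 : X 0 ^ k ∣ f := by
    have h1 : binom 1 (-1) ^ k ∣ f := by
      refine (pow_dvd_pow_of_dvd ⟨(X 0 - X 1) * (X 0 ^ 2 + X 1 ^ 2), ?_⟩ k).trans g2
      simp only [binom, C_neg, C_1]
      ring
    have h2 : binom 1 0 ^ k ∣ f :=
      binom_pow_dvd_of_subst_T hT hα (by norm_num) h1
    simpa [binom] using h2
  exact ⟨g2, g3⟩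

lemma isUnit_C_neg_one_pow (k : ℕ) : IsUnit (C ((-1) ^ k) : MvPolynomial (Fin 2) ℂ) :=
  (isUnit_neg_one.pow k).map C

lemma Gam_pow_dvd {f : MvPolynomial (Fin 2) ℂ} {k : ℕ} {α β : ℂ} (hα : α ≠ 0) (hβ : β ≠ 0)
    (hT : subst T.val f = C α * f) (hD : subst D.val f = C β * f) (hk : X 1 ^ k ∣ f) :
    Gam ^ k ∣ f := by
  obtain ⟨g2, g3⟩ := Gam_factors_pow_dvd hα hβ hT hD hk
  rw [Gam_eq, mul_pow, mul_pow, mul_pow, ← C_pow, (isUnit_C_neg_one_pow k).mul_left_dvd]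
  exact IsRelPrime.mul_dvd (IsRelPrime.mul_left (isRelPrime_binom_X1 4 1 (by norm_num)).pow
    (isRelPrime_X_pow k k)) (IsRelPrime.mul_dvd
      (isRelPrime_binom_X0 4 one_ne_zero (by norm_num)).pow g2 g3) hk

lemma Del_mul_Gam_pow (k : ℕ) :
    Del * Gam ^ k = C ((-1) ^ k) * (binom 4 (-1) * binom 4 ((1 + 2 * rt) ^ 4) *
      binom 4 ((2 * rt - 1) ^ 4) * binom 4 1 ^ k * X 0 ^ k * X 1 ^ k) := by
  have h2 : (C 2 : MvPolynomial (Fin 2) ℂ) = 2 := map_ofNat C 2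
  -- Δ = (x⁴ + y⁴)(x⁸ - 34x⁴y⁴ + y⁸), and 17 ± 12√2 have sum 34 and product 1.
  have hDel : Del = binom 4 (-1) * binom 4 ((1 + 2 * rt) ^ 4) * binom 4 ((2 * rt - 1) ^ 4) := by
    have e1 := one_add_two_rt_pow_four
    have e2 := two_rt_sub_one_pow_four
    have h17 : (C 17 : MvPolynomial (Fin 2) ℂ) = 17 := map_ofNat C 17
    have h24 : (C 24 : MvPolynomial (Fin 2) ℂ) = 24 := map_ofNat C 24
    rw [e1, e2]
    simp only [Del, binom, C_neg, C_1, C_add, C_sub, C_mul, h17, h24]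
    linear_combination 288 * X 1 ^ 8 * (X 0 ^ 4 + X 1 ^ 4) * C_rt_sq
  rw [Gam_eq, hDel, mul_pow, mul_pow, mul_pow, ← C_pow]
  ring

/-- The twelve lines of Δ are the orbit of the mirror of T. They fall into three D-orbits x⁴ = ay⁴,
with a = (1 + √2)⁴, (√2 - 1)⁴ and -1, all different from the orbit a = 1 in Γ. The power of y is a
separate hypothesis because the character of D knows k only modulo 4. -/
lemma Del_mul_Gam_pow_dvd {f : MvPolynomial (Fin 2) ℂ} {k : ℕ} {α : ℂ} (hα : α ≠ 0)
    (hT : subst T.val f = -f) (hD : subst D.val f = C α * f) (hk : X 1 ^ k ∣ f) :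
    Del * Gam ^ k ∣ f := by
  have hr := rt_sq
  have hT' : subst T.val f = C (-1) * f := by rw [hT, C_neg, C_1, neg_one_mul]
  have hα' : (-1 : ℂ) ≠ 0 := by norm_num
  obtain ⟨g2, g3⟩ := Gam_factors_pow_dvd hα' hα hT' hD hk
  -- the orbit of the mirror of `T`
  have hp : 1 + 2 * rt ≠ 0 := fun h =>
    one_ne_zero (α := ℂ) (by linear_combination (2 * rt - 1) * h - 4 * hr)
  have hm : 2 * rt - 1 ≠ 0 := fun h =>
    one_ne_zero (α := ℂ) (by linear_combination (2 * rt + 1) * h - 4 * hr)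
  have m1 : binom 1 (1 + 2 * rt) ^ 1 ∣ f := by
    simpa using binom_dvd_of_subst_T hT
  have m2 := binom_pow_dvd_of_subst_D hD hα hp m1
  have hdvd : ∀ c : ℂ, c ^ 4 = (1 + 2 * rt) ^ 4 → binom 1 c ^ 1 ∣ f := by
    intro c hc
    refine (pow_dvd_pow_of_dvd ⟨(X 0 + C c * X 1) * (X 0 ^ 2 + C c ^ 2 * X 1 ^ 2), ?_⟩ 1).trans m2
    simp only [binom, ← hc, C_pow]
    ring
  -- The Möbius map of T leads to the other two D-orbits: -(1 + √2) goes to √2 - 1, and below i(1 +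
  -- √2) goes to (1 - i)/√2, whose fourth power is -1.
  have m3 : binom 1 (2 * rt - 1) ^ 1 ∣ f :=
    binom_pow_dvd_of_subst_T hT' hα' (c := -(1 + 2 * rt)) (by linear_combination (-4) * hr)
      (hdvd _ (by ring))
  have m4 := binom_pow_dvd_of_subst_D hD hα hm m3
  have hI := Complex.I_sq
  have m5 : binom 1 (rt * (1 - Complex.I)) ^ 1 ∣ f := by
    refine binom_pow_dvd_of_subst_T hT' hα' (c := Complex.I * (1 + 2 * rt)) ?_
      (hdvd _ (by rw [mul_pow, Complex.I_pow_four, one_mul]))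
    linear_combination (2 * Complex.I + 2) * hr + (-rt - 2 * rt ^ 2) * hI
  have hz : rt * (1 - Complex.I) ≠ 0 := by
    refine mul_ne_zero rt_ne_zero (sub_ne_zero.2 fun h => ?_)
    simpa using congrArg Complex.re h
  have m6 := binom_pow_dvd_of_subst_D hD hα hz m5
  have e6 : (rt * (1 - Complex.I)) ^ 4 = -1 := by
    rw [show (rt * (1 - Complex.I)) ^ 4 = (rt ^ 2) ^ 2 * ((1 - Complex.I) ^ 2) ^ 2 by ring, hr]
    linear_combination (1 / 4 * (Complex.I ^ 2 + 6 - 4 * Complex.I - 1)) * hI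
  rw [e6] at m6
  rw [pow_one] at m2 m4 m6
  have e1 := one_add_two_rt_pow_four
  have e2 := two_rt_sub_one_pow_four
  -- Multiplying by the conjugate removes `rt`: 18² - 288 = 36 for comparison with -1, and 16² - 288
  -- = -32 for comparison with 1.
  have d1 : (-1 : ℂ) ≠ (1 + 2 * rt) ^ 4 := by
    rw [e1]
    refine fun h => absurd (show (36 : ℂ) = 0 from ?_) (by norm_num)
    linear_combination -(18 - 24 * rt) * h + 576 * hr
  have d2 : (-1 : ℂ) ≠ (2 * rt - 1) ^ 4 := by
    rw [e2]
    refine fun h => absurd (show (36 : ℂ) = 0 from ?_) (by norm_num)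
    linear_combination -(18 + 24 * rt) * h + 576 * hr
  have d3 : (1 + 2 * rt) ^ 4 ≠ (2 * rt - 1) ^ 4 := by
    rw [e1, e2]
    exact fun h => rt_ne_zero (by linear_combination h / 48)
  have d4 : (1 + 2 * rt) ^ 4 ≠ 1 := by
    rw [e1]
    refine fun h => absurd (show (-32 : ℂ) = 0 from ?_) (by norm_num)
    linear_combination (16 - 24 * rt) * h + 576 * hr
  have d5 : (2 * rt - 1) ^ 4 ≠ 1 := by
    rw [e2]
    refine fun h => absurd (show (-32 : ℂ) = 0 from ?_) (by norm_num)
    linear_combination (16 + 24 * rt) * h + 576 * hr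
  have r0 : ∀ a : ℂ, a ≠ 0 → IsRelPrime (binom 4 a) (X 0 ^ k) := fun a ha =>
    (isRelPrime_binom_X0 4 ha (by norm_num)).pow_right
  have r1 : ∀ a : ℂ, IsRelPrime (binom 4 a) (X 1 ^ k) := fun a =>
    (isRelPrime_binom_X1 4 a (by norm_num)).pow_right
  have r0k := (isRelPrime_binom_X0 4 one_ne_zero (by norm_num)).pow (m := k) (n := k)
  have r1k := (isRelPrime_binom_X1 4 1 (by norm_num)).pow (m := k) (n := k)
  rw [Del_mul_Gam_pow, (isUnit_C_neg_one_pow k).mul_left_dvd]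
  refine IsRelPrime.mul_dvd ?_ (IsRelPrime.mul_dvd ?_ (IsRelPrime.mul_dvd ?_
    (IsRelPrime.mul_dvd ?_ (IsRelPrime.mul_dvd ?_ m6 m2) m4) g2) g3) hk
  · exact ((((r1 _).mul_left (r1 _)).mul_left (r1 _)).mul_left r1k).mul_left
      (isRelPrime_X_pow k k)
  · exact (((r0 _ (by norm_num)).mul_left (r0 _ (pow_ne_zero 4 hp))).mul_left
      (r0 _ (pow_ne_zero 4 hm))).mul_left r0k
  · exact (((isRelPrime_binom (by norm_num)).mul_left (isRelPrime_binom d4)).mul_left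
      (isRelPrime_binom d5)).pow_right
  · exact (isRelPrime_binom d2).mul_left (isRelPrime_binom d3)
  · exact isRelPrime_binom d1

/-! ### The module of covariants -/

/-- This is where kᵢ comes from: it is the integer sum of the least exponents of the two eigenvalues
of D, not reduced modulo 4. -/
lemma rhoD_eq {i : ℕ} (hi : 9 ≤ i) (hi' : i ≤ 20) : ∃ a b : ℕ, a < 4 ∧ b < 4 ∧ a + b = kExp i ∧
    rhoD i = !![Complex.I ^ a, 0; 0, Complex.I ^ b] := by
  have h2 : Complex.I ^ 2 = -1 := Complex.I_sq
  have h3 : Complex.I ^ 3 = -Complex.I := Complex.I_pow_three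
  interval_cases i
  · exact ⟨0, 1, by simp [kExp, rhoD]⟩
  · exact ⟨1, 2, by simp [kExp, rhoD, h2]⟩
  · exact ⟨2, 3, by simp [kExp, rhoD, h2, h3]⟩
  · exact ⟨3, 0, by simp [kExp, rhoD, h3]⟩
  · exact ⟨0, 1, by simp [kExp, rhoD]⟩
  · exact ⟨1, 2, by simp [kExp, rhoD, h2]⟩
  · exact ⟨2, 3, by simp [kExp, rhoD, h2, h3]⟩
  · exact ⟨3, 0, by simp [kExp, rhoD, h3]⟩
  · exact ⟨2, 0, by simp [kExp, rhoD, h2]⟩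
  · exact ⟨1, 3, by simp [kExp, rhoD, h3]⟩
  · exact ⟨0, 2, by simp [kExp, rhoD, h2]⟩
  · exact ⟨3, 1, by simp [kExp, rhoD, h3]⟩

lemma det_rhoT {i : ℕ} (hi : 9 ≤ i) (hi' : i ≤ 20) : (rhoT i).det = -1 := by
  have hT : T.val.det = -1 := by
    rw [T_val, Matrix.det_smul, Fintype.card_fin, ← rt, rt_sq, Matrix.det_fin_two_of]
    norm_num
  have hT' : (-T.val).det = -1 := by
    rw [Matrix.det_neg, hT]
    norm_num
  interval_cases i
  · exact hT
  · exact hT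
  · exact hT
  · exact hT
  · exact hT'
  · exact hT'
  · exact hT'
  · exact hT'
  all_goals
    simp only [rhoT, Matrix.det_fin_two_of]
    norm_num

lemma exists_basis_of_bijective {ι R M : Type*} [Finite ι] [DecidableEq ι] [Semiring R]
    [AddCommMonoid M] [Module R M] (f : (ι → R) →ₗ[R] M) (hf : Function.Bijective f) :
    ∃ B : Module.Basis ι R M, ∀ j, B j = f (Pi.single j 1) :=
  ⟨Module.Basis.ofEquivFun (LinearEquiv.ofBijective f hf).symm, fun j => by
    rw [Module.Basis.coe_ofEquivFun, LinearEquiv.symm_symm]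
    rfl⟩

/-- The determinant of two vectors of polynomials. -/
noncomputable def bracket (F H : Fin 2 → MvPolynomial (Fin 2) ℂ) : MvPolynomial (Fin 2) ℂ :=
  F 0 * H 1 - F 1 * H 0

/-! ### Brackets and Cramer's rule -/

section Bracket

variable {i : ℕ} {F H : Fin 2 → MvPolynomial (Fin 2) ℂ}

lemma subst_T_bracket (hi : 9 ≤ i) (hi' : i ≤ 20) (hF : F ∈ covariants (rho i))
    (hH : H ∈ covariants (rho i)) : subst T.val (bracket F H) = -bracket F H := by
  have h := congrArg (C (σ := Fin 2)) (det_rhoT hi hi')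
  simp only [Matrix.det_fin_two, C_sub, C_mul, C_neg, C_1] at h
  simp only [bracket, map_sub, map_mul, subst_T_of_mem hF, subst_T_of_mem hH, Fin.sum_univ_two]
  linear_combination (F 0 * H 1 - F 1 * H 0) * h

lemma subst_D_of_mem_zero {a b : ℂ} (h : rhoD i = !![a, 0; 0, b])
    (hF : F ∈ covariants (rho i)) : subst D.val (F 0) = C a * F 0 := by
  simp [subst_D_of_mem hF, h]

lemma subst_D_of_mem_one {a b : ℂ} (h : rhoD i = !![a, 0; 0, b])
    (hF : F ∈ covariants (rho i)) : subst D.val (F 1) = C b * F 1 := by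
  simp [subst_D_of_mem hF, h]

lemma subst_D_bracket (hi : 9 ≤ i) (hi' : i ≤ 20) (hF : F ∈ covariants (rho i))
    (hH : H ∈ covariants (rho i)) :
    subst D.val (bracket F H) = C (Complex.I ^ kExp i) * bracket F H := by
  obtain ⟨a, b, -, -, hab, h⟩ := rhoD_eq hi hi'
  simp only [bracket, map_sub, map_mul, subst_D_of_mem_zero h hF, subst_D_of_mem_one h hF,
    subst_D_of_mem_zero h hH, subst_D_of_mem_one h hH, ← hab, pow_add]
  ring

/-- As kᵢ can exceed 3, the power of y is found entrywise: y^a divides every first entry and y^b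
every second, so y^(a+b) divides both products in the bracket. -/
lemma Del_mul_Gam_pow_dvd_bracket (hi : 9 ≤ i) (hi' : i ≤ 20) (hF : F ∈ covariants (rho i))
    (hH : H ∈ covariants (rho i)) : Del * Gam ^ kExp i ∣ bracket F H := by
  refine Del_mul_Gam_pow_dvd (pow_ne_zero _ Complex.I_ne_zero) (subst_T_bracket hi hi' hF hH)
    (subst_D_bracket hi hi' hF hH) ?_
  obtain ⟨a, b, ha, hb, hab, h⟩ := rhoD_eq hi hi'
  have key : ∀ {F}, F ∈ covariants (rho i) → X 1 ^ a ∣ F 0 ∧ X 1 ^ b ∣ F 1 := fun hF =>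
    ⟨X1_pow_dvd_of_subst_D ha (subst_D_of_mem_zero h hF),
      X1_pow_dvd_of_subst_D hb (subst_D_of_mem_one h hF)⟩
  rw [← hab, pow_add, bracket]
  refine dvd_sub (mul_dvd_mul (key hF).1 (key hH).2) ?_
  rw [mul_comm (F 1)]
  exact mul_dvd_mul (key hH).1 (key hF).2

lemma Del_ne_zero : Del ≠ 0 := by
  intro h
  have h1 := congrArg (eval ![1, 0]) h
  simp [Del] at h1

lemma Gam_ne_zero : Gam ≠ 0 := by
  intro h
  have h1 := congrArg (eval ![1, 2]) h
  simp [Gam] at h1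
  norm_num at h1

variable {u v : Fin 2 → MvPolynomial (Fin 2) ℂ} {c : ℂ}

lemma bracket_ne_zero {k : ℕ} (hc : c ≠ 0) (h : bracket u v = C c * Del * Gam ^ k) :
    bracket u v ≠ 0 := by
  rw [h]
  exact mul_ne_zero (mul_ne_zero (C_ne_zero.2 hc) Del_ne_zero) (pow_ne_zero _ Gam_ne_zero)

/-- The quotient of two brackets is an invariant. -/
lemma exists_invariant_mul_bracket (hi : 9 ≤ i) (hi' : i ≤ 20) (hc : c ≠ 0)
    (hu : u ∈ covariants (rho i)) (hv : v ∈ covariants (rho i))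
    (h : bracket u v = C c * Del * Gam ^ kExp i) (hF : F ∈ covariants (rho i))
    (hH : H ∈ covariants (rho i)) :
    ∃ r : invariants group, bracket F H = r * bracket u v := by
  obtain ⟨q, hq⟩ := Del_mul_Gam_pow_dvd_bracket hi hi' hF hH
  have h0 := bracket_ne_zero hc h
  have hr : bracket F H = C c⁻¹ * q * bracket u v := by
    have h1 : C c⁻¹ * C c = (1 : MvPolynomial (Fin 2) ℂ) := by
      rw [← C_mul, inv_mul_cancel₀ hc, C_1]
    rw [hq, h]
    linear_combination -(q * Del * Gam ^ kExp i) * h1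
  refine ⟨⟨C c⁻¹ * q, mem_invariants ?_ ?_⟩, hr⟩
  -- Both brackets carry the character det ρ, so it cancels from the quotient.
  · have h1 := congrArg (subst T.val) hr
    rw [map_mul, subst_T_bracket hi hi' hF hH, subst_T_bracket hi hi' hu hv, hr] at h1
    exact mul_right_cancel₀ h0 (by linear_combination h1)
  · have h1 := congrArg (subst D.val) hr
    rw [map_mul, subst_D_bracket hi hi' hF hH, subst_D_bracket hi hi' hu hv, hr] at h1
    have h2 : (C (Complex.I ^ kExp i) : MvPolynomial (Fin 2) ℂ) ≠ 0 :=
      C_ne_zero.2 (pow_ne_zero _ Complex.I_ne_zero)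
    exact mul_right_cancel₀ (mul_ne_zero h2 h0) (by linear_combination -h1)

/-- Cramer's rule: the coordinates are the quotients of the brackets of F, v and of u, F by that of
u, v. -/
lemma exists_coordinates (hi : 9 ≤ i) (hi' : i ≤ 20) (hc : c ≠ 0)
    (hu : u ∈ covariants (rho i)) (hv : v ∈ covariants (rho i))
    (h : bracket u v = C c * Del * Gam ^ kExp i) (hF : F ∈ covariants (rho i)) :
    ∃ r s : invariants group, r • u + s • v = F := by
  obtain ⟨r, hr⟩ := exists_invariant_mul_bracket hi hi' hc hu hv h hF hv
  obtain ⟨s, hs⟩ := exists_invariant_mul_bracket hi hi' hc hu hv h hu hF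
  refine ⟨r, s, funext fun a => mul_right_cancel₀ (bracket_ne_zero hc h) ?_⟩
  have e : (r • u + s • v) a = (r : MvPolynomial (Fin 2) ℂ) * u a + s * v a := rfl
  rw [e, add_mul, mul_right_comm, ← hr, mul_right_comm, ← hs]
  fin_cases a <;> simp only [bracket, Fin.zero_eta, Fin.mk_one] <;> ring

set_option synthInstance.maxHeartbeats 200000 in
lemma exists_basis (hi : 9 ≤ i) (hi' : i ≤ 20) (hc : c ≠ 0)
    (hu : u ∈ covariants (rho i)) (hv : v ∈ covariants (rho i))
    (h : bracket u v = C c * Del * Gam ^ kExp i) :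
    ∃ B : Module.Basis (Fin 2) (invariants group) (covariants (rho i)),
      (B 0 : Fin 2 → MvPolynomial (Fin 2) ℂ) = u ∧ (B 1 : Fin 2 → MvPolynomial (Fin 2) ℂ) = v := by
  have h0 := bracket_ne_zero hc h
  let f : (Fin 2 → invariants group) →ₗ[invariants group] covariants (rho i) :=
    { toFun := fun r => ⟨r 0 • u + r 1 • v,
        add_mem (Submodule.smul_mem _ _ hu) (Submodule.smul_mem _ _ hv)⟩
      map_add' := fun r s => Subtype.ext (funext fun a => by
        change (r 0 + s 0).1 * u a + (r 1 + s 1).1 * v a =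
          (r 0).1 * u a + (r 1).1 * v a + ((s 0).1 * u a + (s 1).1 * v a)
        simp only [Subalgebra.coe_add]
        ring)
      map_smul' := fun r s => Subtype.ext (funext fun a => by
        change (r * s 0).1 * u a + (r * s 1).1 * v a = r.1 * ((s 0).1 * u a + (s 1).1 * v a)
        simp only [Subalgebra.coe_mul]
        ring) }
  have hval : ∀ r a, (f r : Fin 2 → MvPolynomial (Fin 2) ℂ) a = (r 0).1 * u a + (r 1).1 * v a :=
    fun _ _ => rfl
  have hinj : Function.Injective f := by
    intro r s hrs
    have e : ∀ a, (r 0).1 * u a + (r 1).1 * v a = (s 0).1 * u a + (s 1).1 * v a := fun a =>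
      congrFun (congrArg Subtype.val hrs) a
    have e0 := e 0
    have e1 := e 1
    have h1 : (r 0).1 = (s 0).1 := mul_right_cancel₀ h0 (by
      rw [bracket]
      linear_combination v 1 * e0 - v 0 * e1)
    have h2 : (r 1).1 = (s 1).1 := mul_right_cancel₀ h0 (by
      rw [bracket]
      linear_combination u 0 * e1 - u 1 * e0)
    funext j
    fin_cases j
    · exact Subtype.ext h1
    · exact Subtype.ext h2
  have hsurj : Function.Surjective f := by
    rintro ⟨F, hF⟩
    obtain ⟨r, s, hrs⟩ := exists_coordinates hi hi' hc hu hv h hF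
    exact ⟨![r, s], Subtype.ext hrs⟩
  obtain ⟨B, hB⟩ := exists_basis_of_bijective f ⟨hinj, hsurj⟩
  refine ⟨B, ?_, ?_⟩
  all_goals
    rw [hB]
    funext a
    rw [hval]
    simp

end Bracket

/-! ### Hilbert series -/

lemma isHomogeneous_Gam : Gam.IsHomogeneous 6 := by
  have h0 := isHomogeneous_X ℂ (0 : Fin 2)
  have h1 := isHomogeneous_X ℂ (1 : Fin 2)
  exact ((h0.pow 5).neg.mul h1).add (h0.mul (h1.pow 5))

/-- Homogeneity is an eigenvalue condition for the dilation by 2, so a nonzero homogeneous factor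
can be cancelled. The right side says that a has degree d - e, or vanishes if d < e. -/
lemma isHomogeneous_mul_iff {σ : ℕ} {p a : MvPolynomial (Fin σ) ℂ} {d e : ℕ}
    (hp : p.IsHomogeneous e) (hp0 : p ≠ 0) :
    (p * a).IsHomogeneous d ↔ ∀ s, coeff s a ≠ 0 → s.degree + e = d := by
  constructor
  · intro h
    refine isHomogeneous_of_subst_two (mul_left_cancel₀ hp0 ?_)
    have h1 := subst_two_of_isHomogeneous h
    rw [map_mul, subst_two_of_isHomogeneous hp] at h1
    linear_combination h1
  · intro h
    by_cases ha : a = 0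
    · rw [ha, mul_zero]
      exact isHomogeneous_zero _ _ _
    obtain ⟨s, hs⟩ := ne_zero_iff.1 ha
    have hse := h s hs
    have ha' : a.IsHomogeneous (d - e) := fun t ht => by
      have h1 := h t ht
      have h2 : Finsupp.weight 1 t = t.degree := by
        rw [Finsupp.degree_eq_weight_one]
        rfl
      rw [h2]
      omega
    have h3 := hp.mul ha'
    rwa [show e + (d - e) = d by omega] at h3

/-- The invariants that are homogeneous of degree `d - e`; zero if `d < e`. -/
def invariantsOfDegree (e d : ℕ) : Submodule ℂ (MvPolynomial (Fin 2) ℂ) where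
  carrier := {a | a ∈ invariants group ∧ ∀ s, coeff s a ≠ 0 → s.degree + e = d}
  add_mem' {a b} ha hb := ⟨add_mem ha.1 hb.1, fun s hs => by
    by_cases h : coeff s a = 0
    · exact hb.2 s fun h' => hs (by rw [coeff_add, h, h', add_zero])
    · exact ha.2 s h⟩
  zero_mem' := ⟨zero_mem _, fun s hs => absurd (coeff_zero s) hs⟩
  smul_mem' c a ha := ⟨Subalgebra.smul_mem _ ha.1 c, fun s hs => ha.2 s fun h => hs (by
    rw [coeff_smul, h, smul_zero])⟩

lemma isHomogeneous_of_mem {d : ℕ} {a : MvPolynomial (Fin 2) ℂ}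
    (ha : a ∈ invariantsOfDegree 0 d) : a.IsHomogeneous d := by
  have h := (isHomogeneous_mul_iff (a := a) (d := d) (isHomogeneous_one (Fin 2) ℂ) one_ne_zero).2
    ha.2
  rwa [one_mul] at h

lemma mem_invariantsOfDegree_zero {d : ℕ} {a : MvPolynomial (Fin 2) ℂ} (ha : a ∈ invariants group)
    (h : a.IsHomogeneous d) : a ∈ invariantsOfDegree 0 d := by
  refine ⟨ha, ?_⟩
  rw [← isHomogeneous_mul_iff (isHomogeneous_one (Fin 2) ℂ) one_ne_zero, one_mul]
  exact h

instance finite_invariantsOfDegree (e d : ℕ) : Module.Finite ℂ (invariantsOfDegree e d) := by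
  have : Module.Finite ℂ (homogeneousSubmodule (Fin 2) ℂ d) :=
    Module.Finite.iff_fg.2 (homogeneousSubmodule_fg (σ := Fin 2) (R := ℂ) d)
  -- Multiplication by x^e restores degree d and embeds the space into the forms of that degree.
  let f : invariantsOfDegree e d →ₗ[ℂ] homogeneousSubmodule (Fin 2) ℂ d :=
    { toFun := fun a => ⟨X 0 ^ e * a.1, (isHomogeneous_mul_iff (isHomogeneous_X_pow 0 e)
        (pow_ne_zero _ (X_ne_zero 0))).2 a.2.2⟩
      map_add' := fun a b => Subtype.ext (mul_add _ _ _)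
      map_smul' := fun c a => Subtype.ext (mul_smul_comm _ _ _) }
  refine Module.Finite.of_injective f fun a b h => Subtype.ext ?_
  exact mul_left_cancel₀ (pow_ne_zero _ (X_ne_zero 0)) (congrArg Subtype.val h)

lemma finrank_invariantsOfDegree (e d : ℕ) : Module.finrank ℂ (invariantsOfDegree e d) =
    if e ≤ d then Module.finrank ℂ (invariantsOfDegree 0 (d - e)) else 0 := by
  split_ifs with h
  · have h1 : invariantsOfDegree e d = invariantsOfDegree 0 (d - e) := by
      ext a
      refine and_congr_right fun _ => forall₂_congr fun s _ => ?_
      omega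
    rw [h1]
  · have h1 : invariantsOfDegree e d = ⊥ := by
      refine (Submodule.eq_bot_iff _).2 fun a ha => ?_
      ext s
      by_contra hs
      have := ha.2 s hs
      omega
    rw [h1, finrank_bot]

/-! ### The Hilbert series of the invariants -/

/-- The invariant `x⁸ + 14x⁴y⁴ + y⁸`. -/
noncomputable def theta : MvPolynomial (Fin 2) ℂ := X 0 ^ 8 + 14 * X 0 ^ 4 * X 1 ^ 4 + X 1 ^ 8

lemma isHomogeneous_theta : theta.IsHomogeneous 8 := by
  have h0 := isHomogeneous_X ℂ (0 : Fin 2)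
  have h1 := isHomogeneous_X ℂ (1 : Fin 2)
  have h14 : (14 : MvPolynomial (Fin 2) ℂ).IsHomogeneous 0 := by
    rw [← map_ofNat C 14]
    exact isHomogeneous_C _ _
  exact ((h0.pow 8).add ((h14.mul (h0.pow 4)).mul (h1.pow 4))).add (h1.pow 8)

lemma subst_T_theta : subst T.val theta = theta := by
  simp only [theta, map_add, map_mul, map_pow, subst_T_X0, subst_T_X1, map_ofNat]
  have h := C_rt_sq
  have h8 : (C rt : MvPolynomial (Fin 2) ℂ) ^ 8 * 16 = 1 := by
    linear_combination (2 ^ 3 * C rt ^ 6 + 2 ^ 2 * C rt ^ 4 + 2 * C rt ^ 2 + 1) * h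
  linear_combination (X 0 ^ 8 + 14 * X 0 ^ 4 * X 1 ^ 4 + X 1 ^ 8) * h8

lemma subst_D_theta : subst D.val theta = theta := by
  simp only [theta, map_add, map_mul, map_pow, subst_D_X0, subst_D_X1, map_ofNat]
  linear_combination (14 * X 0 ^ 4 * X 1 ^ 4 + X 1 ^ 8 * (C Complex.I ^ 4 + 1)) * C_I_pow_four

lemma subst_T_Gam : subst T.val Gam = Gam := by
  simp only [Gam, map_add, map_mul, map_neg, map_pow, subst_T_X0, subst_T_X1]
  have h := C_rt_sq
  have h6 : (C rt : MvPolynomial (Fin 2) ℂ) ^ 6 * 8 = 1 := by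
    linear_combination (2 ^ 2 * C rt ^ 4 + 2 * C rt ^ 2 + 1) * h
  linear_combination (-X 0 ^ 5 * X 1 + X 0 * X 1 ^ 5) * h6

lemma subst_D_Gam : subst D.val Gam = C Complex.I * Gam := by
  simp only [Gam, map_add, map_mul, map_neg, map_pow, subst_D_X0, subst_D_X1]
  linear_combination C Complex.I * X 0 * X 1 ^ 5 * C_I_pow_four

/-- The group contains the scalar (TD)³ = (1 + i)/√2, a primitive eighth root of unity, which acts
on degree n by its n-th power. -/
lemma eight_dvd_of_coeff_ne_zero {f : MvPolynomial (Fin 2) ℂ} (hf : f ∈ invariants group)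
    {s : Fin 2 →₀ ℕ} (hs : coeff s f ≠ 0) : 8 ∣ s.degree := by
  set z : ℂ := rt * (1 + Complex.I)
  have hI := Complex.I_sq
  have hz4 : z ^ 4 = -1 := by
    rw [show z ^ 4 = (rt ^ 2) ^ 2 * ((1 + Complex.I) ^ 2) ^ 2 by ring, rt_sq]
    linear_combination (1 / 4 * (Complex.I ^ 2 + 6 + 4 * Complex.I - 1)) * hI
  have hM : T.val * D.val * (T.val * D.val) * (T.val * D.val) = Matrix.diagonal fun _ => z := by
    have h3 : rt ^ 3 * 2 = rt := by linear_combination 2 * rt * rt_sq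
    have e : T.val * D.val = rt • !![1, Complex.I; 1, -Complex.I] := by
      rw [T_val, D_val, ← rt, Matrix.smul_mul, Matrix.mul_fin_two]
      simp
    rw [e]
    ext a b
    fin_cases a <;> fin_cases b <;>
      simp [Matrix.mul_apply, Fin.sum_univ_two, z]
    · linear_combination (1 + Complex.I) * h3 - rt ^ 3 * hI
    · linear_combination rt ^ 3 * Complex.I * hI
    · linear_combination rt ^ 3 * hI
    · linear_combination (1 + Complex.I) * h3 - rt ^ 3 * (2 + Complex.I) * hI
  have h1 := congrArg (coeff s) (congrArg (fun A => subst A f) hM)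
  simp only [subst_mul, subst_T_of_mem_invariants hf, subst_D_of_mem_invariants hf] at h1
  rw [coeff_subst_diagonal, Finset.prod_pow_eq_pow_sum] at h1
  have h2 : z ^ s.degree = 1 := by
    rw [Finsupp.degree_eq_sum]
    exact mul_right_cancel₀ hs (by rw [one_mul, ← h1])
  have ho : orderOf z = 8 := by
    refine orderOf_eq_prime_pow (p := 2) (n := 2) ?_ ?_
    · rw [show 2 ^ 2 = 4 by norm_num, hz4]
      norm_num
    · rw [show 2 ^ (2 + 1) = 4 * 2 by norm_num, pow_mul, hz4]
      norm_num
  rw [← ho]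
  exact orderOf_dvd_of_pow_eq_one h2

/-- Modulo y, `theta` is x⁸. Its powers show that the coefficient of x^d is not always zero when 8
divides d. -/
lemma coeff_theta_pow (j : ℕ) : coeff (Finsupp.single 0 (8 * j)) (theta ^ j) = 1 := by
  obtain ⟨q, hq⟩ := sub_dvd_pow_sub_pow theta (X 0 ^ 8) j
  have e : theta ^ j = X 0 ^ (8 * j) + X 1 * ((14 * X 0 ^ 4 * X 1 ^ 3 + X 1 ^ 7) * q) := by
    rw [pow_mul]
    rw [theta] at hq ⊢
    linear_combination hq
  rw [e, coeff_add, coeff_X_mul', if_neg (by simp), add_zero, X_pow_eq_monomial, coeff_monomial,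
    if_pos rfl]

lemma isHomogeneous_Gam_pow_four : (Gam ^ 4).IsHomogeneous 24 := isHomogeneous_Gam.pow 4

lemma Gam_pow_four_mul_mem {a : MvPolynomial (Fin 2) ℂ} :
    Gam ^ 4 * a ∈ invariants group ↔ a ∈ invariants group := by
  have hT : subst T.val (Gam ^ 4) = Gam ^ 4 := by rw [map_pow, subst_T_Gam]
  have hD : subst D.val (Gam ^ 4) = Gam ^ 4 := by
    rw [map_pow, subst_D_Gam, mul_pow, C_I_pow_four, one_mul]
  have h0 : Gam ^ 4 ≠ 0 := pow_ne_zero _ Gam_ne_zero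
  constructor
  · intro h
    refine mem_invariants (mul_left_cancel₀ h0 ?_) (mul_left_cancel₀ h0 ?_)
    · have h1 := subst_T_of_mem_invariants h
      rwa [map_mul, hT] at h1
    · have h1 := subst_D_of_mem_invariants h
      rwa [map_mul, hD] at h1
  · exact mul_mem (mem_invariants hT hD)

/-- An invariant without a pure power of `x` is divisible by `Γ⁴`. -/
lemma Gam_pow_four_dvd {d : ℕ} {f : MvPolynomial (Fin 2) ℂ} (hf : f ∈ invariantsOfDegree 0 d)
    (h : coeff (Finsupp.single 0 d) f = 0) : Gam ^ 4 ∣ f := by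
  have hT := subst_T_of_mem_invariants hf.1
  have hD := subst_D_of_mem_invariants hf.1
  -- It suffices that y⁴ divides f. Invariance under D makes every y-exponent a multiple of 4, and
  -- exponent 0 would mean the excluded monomial x^d.
  refine Gam_pow_dvd (α := 1) (β := 1) one_ne_zero one_ne_zero (by simpa using hT)
    (by simpa using hD) (X_pow_dvd_of_coeff fun s hs => ?_)
  have h1 := congrArg (coeff s) hD
  rw [coeff_subst_D] at h1
  have h2 : Complex.I ^ s 1 = 1 := mul_right_cancel₀ hs (by rw [h1, one_mul])
  have h3 : 4 ∣ s 1 := by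
    rw [Complex.I_pow_eq_pow_mod] at h2
    have h4 : s 1 % 4 < 4 := Nat.mod_lt _ (by norm_num)
    refine Nat.dvd_of_mod_eq_zero ?_
    generalize s 1 % 4 = j at h2 h4
    interval_cases j
    · rfl
    all_goals norm_num [Complex.ext_iff, pow_succ] at h2
  refine Nat.le_of_dvd (Nat.pos_of_ne_zero fun h0 => hs ?_) h3
  have h4 := hf.2 s hs
  have h5 : s = Finsupp.single 0 d := by
    rw [Finsupp.degree_eq_sum, Fin.sum_univ_two, h0] at h4
    ext j
    fin_cases j
    · simpa using h4
    · simpa using h0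
  rw [h5, h]

/-- Rank-nullity for the coefficient of x^d: `theta` and the scalar of order 8 determine the image,
and the kernel is Γ⁴ times the invariants of degree d - 24. -/
lemma finrank_invariantsOfDegree_zero (d : ℕ) : Module.finrank ℂ (invariantsOfDegree 0 d) =
    (if 8 ∣ d then 1 else 0) + Module.finrank ℂ (invariantsOfDegree 24 d) := by
  let φ : invariantsOfDegree 0 d →ₗ[ℂ] ℂ :=
    (lcoeff ℂ (Finsupp.single 0 d)).comp (invariantsOfDegree 0 d).subtype
  have hφ : ∀ f, φ f = coeff (Finsupp.single 0 d) f.1 := fun _ => rfl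
  have hrange : Module.finrank ℂ (LinearMap.range φ) = if 8 ∣ d then 1 else 0 := by
    split_ifs with h
    · obtain ⟨j, rfl⟩ := h
      have h1 : LinearMap.range φ = ⊤ := LinearMap.range_eq_top.2 fun c => by
        have hm : theta ^ j ∈ invariantsOfDegree 0 (8 * j) :=
          mem_invariantsOfDegree_zero
            (pow_mem (mem_invariants subst_T_theta subst_D_theta) j) (isHomogeneous_theta.pow j)
        refine ⟨c • ⟨theta ^ j, hm⟩, ?_⟩
        rw [map_smul, hφ, coeff_theta_pow, smul_eq_mul, mul_one]
      rw [h1, finrank_top, Module.finrank_self]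
    · have h1 : φ = 0 := by
        ext f
        by_contra hc
        refine h ?_
        have h2 := eight_dvd_of_coeff_ne_zero f.2.1 hc
        rwa [Finsupp.degree_single] at h2
      rw [h1, LinearMap.range_zero, finrank_bot]
  have hker : Module.finrank ℂ (LinearMap.ker φ) = Module.finrank ℂ (invariantsOfDegree 24 d) := by
    have h0 : Gam ^ 4 ≠ 0 := pow_ne_zero _ Gam_ne_zero
    have hcoeff : ∀ a : MvPolynomial (Fin 2) ℂ,
        coeff (Finsupp.single 0 d) (Gam ^ 4 * a) = 0 := fun a => by
      have e : Gam ^ 4 * a = X 1 * ((-X 0 ^ 5 + X 0 * X 1 ^ 4) * Gam ^ 3 * a) := by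
        rw [Gam]
        ring
      rw [e, coeff_X_mul', if_neg]
      simp
    have hmem : ∀ a ∈ invariantsOfDegree 24 d, Gam ^ 4 * a ∈ invariantsOfDegree 0 d :=
      fun a ha => mem_invariantsOfDegree_zero (Gam_pow_four_mul_mem.2 ha.1)
        ((isHomogeneous_mul_iff isHomogeneous_Gam_pow_four h0).2 ha.2)
    let ψ : invariantsOfDegree 24 d →ₗ[ℂ] LinearMap.ker φ :=
      { toFun := fun a => ⟨⟨Gam ^ 4 * a.1, hmem _ a.2⟩, hcoeff a.1⟩
        map_add' := fun a b => Subtype.ext (Subtype.ext (mul_add _ _ _))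
        map_smul' := fun c a => Subtype.ext (Subtype.ext (mul_smul_comm _ _ _)) }
    refine (LinearEquiv.finrank_eq (LinearEquiv.ofBijective ψ ⟨fun a b h => ?_, fun f => ?_⟩)).symm
    · exact Subtype.ext (mul_left_cancel₀ h0 (congrArg (fun x => x.1.1) h))
    · obtain ⟨a, ha⟩ := Gam_pow_four_dvd f.1.2 f.2
      have hm := f.1.2.1
      have hh := isHomogeneous_of_mem f.1.2
      rw [ha] at hm hh
      exact ⟨⟨a, Gam_pow_four_mul_mem.1 hm,
        (isHomogeneous_mul_iff isHomogeneous_Gam_pow_four h0).1 hh⟩,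
        Subtype.ext (Subtype.ext ha.symm)⟩
  rw [← LinearMap.finrank_range_add_finrank_ker φ, hrange, hker]

/-- The Hilbert series of the ring of invariants. -/
noncomputable def invariantSeries : PowerSeries ℤ :=
  PowerSeries.mk fun d => (Module.finrank ℂ (invariantsOfDegree 0 d) : ℤ)

lemma mk_finrank_invariantsOfDegree (e : ℕ) :
    PowerSeries.mk (fun d => (Module.finrank ℂ (invariantsOfDegree e d) : ℤ)) =
      PowerSeries.X ^ e * invariantSeries := by
  ext d
  rw [PowerSeries.coeff_X_pow_mul', PowerSeries.coeff_mk, finrank_invariantsOfDegree,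
    invariantSeries, PowerSeries.coeff_mk]
  split_ifs <;> rfl

lemma invariantSeries_mul :
    invariantSeries * ((1 - PowerSeries.X ^ 8) * (1 - PowerSeries.X ^ 24)) = 1 := by
  set S : PowerSeries ℤ := PowerSeries.mk fun d => if 8 ∣ d then 1 else 0 with hS
  have h1 : invariantSeries = S + PowerSeries.X ^ 24 * invariantSeries := by
    rw [← mk_finrank_invariantsOfDegree, hS]
    ext d
    rw [invariantSeries, map_add, PowerSeries.coeff_mk, PowerSeries.coeff_mk, PowerSeries.coeff_mk,
      finrank_invariantsOfDegree_zero]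
    push_cast
    rfl
  have h2 : S = 1 + PowerSeries.X ^ 8 * S := by
    ext d
    rw [map_add, PowerSeries.coeff_X_pow_mul', hS, PowerSeries.coeff_mk, PowerSeries.coeff_one,
      PowerSeries.coeff_mk]
    split_ifs <;> omega
  linear_combination (1 - PowerSeries.X ^ 8) * h1 + h2

/-! ### The Hilbert series of the covariants -/

section Series

variable {i d₁ d₂ : ℕ} {c : ℂ} {u v : Fin 2 → MvPolynomial (Fin 2) ℂ}

lemma finrank_covariantsOfDegree (hi : 9 ≤ i) (hi' : i ≤ 20) (hc : c ≠ 0)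
    (hu : u ∈ covariants (rho i)) (hv : v ∈ covariants (rho i))
    (hud : IsHomogeneousVec u d₁) (hvd : IsHomogeneousVec v d₂)
    (h : bracket u v = C c * Del * Gam ^ kExp i) (d : ℕ) :
    Module.finrank ℂ (covariantsOfDegree (rho i) d) =
      Module.finrank ℂ (invariantsOfDegree d₁ d) + Module.finrank ℂ (invariantsOfDegree d₂ d) := by
  have h0 := bracket_ne_zero hc h
  have hbr : ∀ {F H : Fin 2 → MvPolynomial (Fin 2) ℂ} {m n : ℕ}, IsHomogeneousVec F m →
      IsHomogeneousVec H n → (bracket F H).IsHomogeneous (m + n) := fun hF hH =>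
    ((hF 0).mul (hH 1)).sub ((hF 1).mul (hH 0))
  have hmul : ∀ {p a : MvPolynomial (Fin 2) ℂ} {e : ℕ}, p.IsHomogeneous e →
      a ∈ invariantsOfDegree e d → (a * p).IsHomogeneous d := by
    intro p a e hp ha
    by_cases hp0 : p = 0
    · rw [hp0, mul_zero]
      exact isHomogeneous_zero _ _ _
    · rw [mul_comm]
      exact (isHomogeneous_mul_iff hp hp0).2 ha.2
  let f : (invariantsOfDegree d₁ d × invariantsOfDegree d₂ d) →ₗ[ℂ] covariantsOfDegree (rho i) d :=
    { toFun := fun r => ⟨fun a => r.1.1 * u a + r.2.1 * v a,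
        add_mem (Submodule.smul_mem (covariants (rho i)) ⟨r.1.1, r.1.2.1⟩ hu)
          (Submodule.smul_mem (covariants (rho i)) ⟨r.2.1, r.2.2.1⟩ hv),
        fun a => (hmul (hud a) r.1.2).add (hmul (hvd a) r.2.2)⟩
      map_add' := fun r s => Subtype.ext (funext fun a => by
        change (r.1.1 + s.1.1) * u a + (r.2.1 + s.2.1) * v a =
          r.1.1 * u a + r.2.1 * v a + (s.1.1 * u a + s.2.1 * v a)
        ring)
      map_smul' := fun c r => Subtype.ext (funext fun a => by
        change (c • r.1.1) * u a + (c • r.2.1) * v a = c • (r.1.1 * u a + r.2.1 * v a)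
        rw [smul_add, smul_mul_assoc, smul_mul_assoc]) }
  have hinj : Function.Injective f := by
    intro r s hrs
    have e : ∀ a, r.1.1 * u a + r.2.1 * v a = s.1.1 * u a + s.2.1 * v a := fun a =>
      congrFun (congrArg Subtype.val hrs) a
    have e0 := e 0
    have e1 := e 1
    have h1 : r.1.1 = s.1.1 := mul_right_cancel₀ h0 (by
      rw [bracket]
      linear_combination v 1 * e0 - v 0 * e1)
    have h2 : r.2.1 = s.2.1 := mul_right_cancel₀ h0 (by
      rw [bracket]
      linear_combination u 0 * e1 - u 1 * e0)
    exact Prod.ext (Subtype.ext h1) (Subtype.ext h2)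
  have hsurj : Function.Surjective f := by
    rintro ⟨F, hF, hFd⟩
    obtain ⟨r, s, hrs⟩ := exists_coordinates hi hi' hc hu hv h hF
    have e : ∀ a, F a = r.1 * u a + s.1 * v a := fun a => (congrFun hrs a).symm
    have hr : bracket u v * r.1 = bracket F v := by
      rw [bracket, bracket, e, e]
      ring
    have hs : bracket u v * s.1 = bracket u F := by
      rw [bracket, bracket, e, e]
      ring
    -- The brackets of F, v and u, v have degrees d + d₂ and d₁ + d₂, so r has degree d - d₁;
    -- likewise s has degree d - d₂.
    have hr' := (isHomogeneous_mul_iff (hbr hud hvd) h0).1 (hr ▸ hbr hFd hvd)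
    have hs' := (isHomogeneous_mul_iff (hbr hud hvd) h0).1 (hs ▸ hbr hud hFd)
    refine ⟨(⟨r.1, r.2, fun t ht => ?_⟩, ⟨s.1, s.2, fun t ht => ?_⟩), Subtype.ext hrs⟩
    · have := hr' t ht
      omega
    · have := hs' t ht
      omega
  rw [← LinearEquiv.finrank_eq (LinearEquiv.ofBijective f ⟨hinj, hsurj⟩), Module.finrank_prod]

lemma hilbertSeries_mul (hi : 9 ≤ i) (hi' : i ≤ 20) (hc : c ≠ 0)
    (hu : u ∈ covariants (rho i)) (hv : v ∈ covariants (rho i))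
    (hud : IsHomogeneousVec u d₁) (hvd : IsHomogeneousVec v d₂)
    (h : bracket u v = C c * Del * Gam ^ kExp i) :
    hilbertSeries (rho i) * ((1 - PowerSeries.X ^ 8) * (1 - PowerSeries.X ^ 24)) =
      PowerSeries.X ^ d₁ + PowerSeries.X ^ d₂ := by
  have h1 : hilbertSeries (rho i) =
      PowerSeries.X ^ d₁ * invariantSeries + PowerSeries.X ^ d₂ * invariantSeries := by
    rw [← mk_finrank_invariantsOfDegree, ← mk_finrank_invariantsOfDegree]
    ext d
    rw [hilbertSeries, map_add, PowerSeries.coeff_mk, PowerSeries.coeff_mk, PowerSeries.coeff_mk,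
      finrank_covariantsOfDegree hi hi' hc hu hv hud hvd h]
    push_cast
    rfl
  rw [h1]
  linear_combination (PowerSeries.X ^ d₁ + PowerSeries.X ^ d₂) * invariantSeries_mul

end Series

/-- The beginning of the expansion of a rational series is found by multiplying out. -/
lemma coeff_eq_of_mul_eq {H P Q N : PowerSeries ℤ} {n : ℕ}
    (hH : H * ((1 - PowerSeries.X ^ 8) * (1 - PowerSeries.X ^ 24)) = N)
    (hP : P * ((1 - PowerSeries.X ^ 8) * (1 - PowerSeries.X ^ 24)) = N + PowerSeries.X ^ n * Q)
    {d : ℕ} (hd : d < n) : PowerSeries.coeff d H = PowerSeries.coeff d P := by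
  -- `invariantSeries` is the inverse of the denominator.
  have h : H = P - PowerSeries.X ^ n * (Q * invariantSeries) := by
    linear_combination invariantSeries * hH - invariantSeries * hP - (H - P) * invariantSeries_mul
  rw [h, map_sub, PowerSeries.coeff_X_pow_mul', if_neg (by omega), sub_zero]

/-! ### The generators -/

/-- The vector `F` transforms by the matrix `A` under `T` and by the matrix `B` under `D`. -/
structure IsCovariant (A B : Matrix (Fin 2) (Fin 2) ℂ) (F : Fin 2 → MvPolynomial (Fin 2) ℂ) :
    Prop where
  subst_T : ∀ a, subst T.val (F a) = ∑ b, C (A a b) * F b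
  subst_D : ∀ a, subst D.val (F a) = ∑ b, C (B a b) * F b

lemma IsCovariant.mul {A B : Matrix (Fin 2) (Fin 2) ℂ} {F : Fin 2 → MvPolynomial (Fin 2) ℂ}
    (hF : IsCovariant A B F) {p : MvPolynomial (Fin 2) ℂ} {α β : ℂ}
    (hT : G9.subst T.val p = C α * p) (hD : G9.subst D.val p = C β * p) :
    IsCovariant (α • A) (β • B) fun a => p * F a where
  subst_T a := by
    simp only [map_mul, hT, hF.subst_T, Finset.mul_sum, Matrix.smul_apply, smul_eq_mul]
    exact Finset.sum_congr rfl fun b _ => by ring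
  subst_D a := by
    simp only [map_mul, hD, hF.subst_D, Finset.mul_sum, Matrix.smul_apply, smul_eq_mul]
    exact Finset.sum_congr rfl fun b _ => by ring

lemma isHomogeneous_Del : Del.IsHomogeneous 12 := by
  have h0 := isHomogeneous_X ℂ (0 : Fin 2)
  have h1 := isHomogeneous_X ℂ (1 : Fin 2)
  have h33 : (33 : MvPolynomial (Fin 2) ℂ).IsHomogeneous 0 := by
    rw [← map_ofNat C 33]
    exact isHomogeneous_C _ _
  exact (((h0.pow 12).sub ((h33.mul (h0.pow 8)).mul (h1.pow 4))).sub
    ((h33.mul (h0.pow 4)).mul (h1.pow 8))).add (h1.pow 12)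

lemma subst_T_Del : subst T.val Del = C (-1) * Del := by
  simp only [Del, map_add, map_sub, map_mul, map_pow, subst_T_X0, subst_T_X1, map_ofNat, C_neg,
    C_1]
  have h12 : (C rt : MvPolynomial (Fin 2) ℂ) ^ 12 * 64 = 1 := by
    linear_combination (2 ^ 5 * C rt ^ 10 + 2 ^ 4 * C rt ^ 8 + 2 ^ 3 * C rt ^ 6 + 2 ^ 2 * C rt ^ 4
      + 2 * C rt ^ 2 + 1) * C_rt_sq
  linear_combination -(X 0 ^ 12 - 33 * X 0 ^ 8 * X 1 ^ 4 - 33 * X 0 ^ 4 * X 1 ^ 8 + X 1 ^ 12) * h12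

lemma subst_D_Del : subst D.val Del = C 1 * Del := by
  simp only [Del, map_add, map_sub, map_mul, map_pow, subst_D_X0, subst_D_X1, map_ofNat, C_1]
  linear_combination (-33 * X 0 ^ 8 * X 1 ^ 4 - 33 * X 0 ^ 4 * X 1 ^ 8 * (C Complex.I ^ 4 + 1) +
    X 1 ^ 12 * (C Complex.I ^ 8 + C Complex.I ^ 4 + 1)) * C_I_pow_four

/-- From two covariants of complementary types one obtains generators of `M(ρᵢ)`. -/
lemma exists_generators_of_isCovariant {i m j a b : ℕ} {A B A' B' : Matrix (Fin 2) (Fin 2) ℂ}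
    {F H : Fin 2 → MvPolynomial (Fin 2) ℂ} {κ : ℂ}
    (hF : IsCovariant A B F) (hH : IsCovariant A' B' H)
    (hFa : IsHomogeneousVec F a) (hHb : IsHomogeneousVec H b)
    (hFH : bracket F H = C κ * Gam ^ j) (hκ : κ ≠ 0)
    (hA : rhoT i = A) (hA' : rhoT i = (-1 : ℂ) • A') (hB : rhoD i = Complex.I ^ m • B)
    (hB' : rhoD i = Complex.I ^ m • B') (hd₁ : deg₁ i = 6 * m + a)
    (hd₂ : deg₂ i = 6 * m + (12 + b)) (hk : kExp i = 2 * m + j) :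
    ∃ u v, u ∈ covariants (rho i) ∧ v ∈ covariants (rho i) ∧ IsHomogeneousVec u (deg₁ i) ∧
      IsHomogeneousVec v (deg₂ i) ∧
      bracket u v = C (cConst i : ℂ) * Del * Gam ^ kExp i := by
  have hGT : subst T.val (Gam ^ m) = C 1 * Gam ^ m := by
    rw [map_pow, subst_T_Gam, C_1, one_mul]
  have hGD : subst D.val (Gam ^ m) = C (Complex.I ^ m) * Gam ^ m := by
    rw [map_pow, subst_D_Gam, mul_pow, C_pow]
  -- Take u = Γ^m F and v = Γ^m Δ H. Γ^m multiplies the action of D by i^m, while Δ changes only the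
  -- sign of T; hence H must agree with F under D and be opposite under T. The constant cᵢ/κ gives
  -- the determinant its prescribed value.
  have hu := hF.mul hGT hGD
  have hv := ((hH.mul subst_T_Del subst_D_Del).mul hGT hGD).mul
    (p := C (cConst i / κ)) (α := 1) (β := 1) (by simp) (by simp)
  rw [one_smul, ← hA, ← hB] at hu
  rw [one_smul, one_smul, one_smul, one_smul, ← hA', ← hB'] at hv
  refine ⟨_, _, mem_covariants_rho hu.subst_T hu.subst_D, mem_covariants_rho hv.subst_T hv.subst_D,
    fun l => ?_, fun l => ?_, ?_⟩
  · rw [hd₁]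
    exact (isHomogeneous_Gam.pow m).mul (hFa l)
  · rw [hd₂, ← zero_add (6 * m + _)]
    exact (isHomogeneous_C _ _).mul ((isHomogeneous_Gam.pow m).mul (isHomogeneous_Del.mul (hHb l)))
  · have h1 : (C (cConst i : ℂ) : MvPolynomial (Fin 2) ℂ) = C (cConst i / κ) * C κ := by
      rw [← C_mul, div_mul_cancel₀ _ hκ]
    rw [bracket] at hFH ⊢
    rw [h1, hk, pow_add, pow_mul']
    linear_combination Gam ^ m * C (cConst i / κ) * (Gam ^ m * Del) * hFH

lemma isCovariant_nat {ε : ℂ} {β : ℂ} {F : Fin 2 → MvPolynomial (Fin 2) ℂ}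
    (h0 : subst T.val (F 0) = C ε * (C rt * (F 0 + F 1)))
    (h1 : subst T.val (F 1) = C ε * (C rt * (F 0 - F 1)))
    (h2 : subst D.val (F 0) = C β * F 0) (h3 : subst D.val (F 1) = C β * (C Complex.I * F 1)) :
    IsCovariant (ε • T.val) (β • D.val) F := by
  constructor
  · intro a
    fin_cases a
    · refine h0.trans ?_
      simp [T_val, ← rt.eq_1]
      ring
    · refine h1.trans ?_
      simp [T_val, ← rt.eq_1]
      ring
  · intro a
    fin_cases a
    · refine h2.trans ?_
      simp [D_val]
    · refine h3.trans ?_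
      simp [D_val]
      ring

lemma two_mul_C_half : (2 : MvPolynomial (Fin 2) ℂ) * C (1 / 2) = 1 := by
  rw [← map_ofNat C 2, ← C_mul, ← C_1]
  norm_num

lemma C_three_half : (C (3 / 2) : MvPolynomial (Fin 2) ℂ) = 3 * C (1 / 2) := by
  rw [← map_ofNat C 3, ← C_mul]
  norm_num

lemma C_neg_half : (C (-1 / 2) : MvPolynomial (Fin 2) ℂ) = -C (1 / 2) := by
  rw [← C_neg]
  norm_num

lemma isCovariant_zero {ε β : ℂ} {F : Fin 2 → MvPolynomial (Fin 2) ℂ}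
    (h0 : 2 * subst T.val (F 0) = C ε * (F 0 + 3 * F 1))
    (h1 : 2 * subst T.val (F 1) = C ε * (F 0 - F 1))
    (h2 : subst D.val (F 0) = C β * F 0) (h3 : subst D.val (F 1) = -(C β * F 1)) :
    IsCovariant (ε • T₀.val) (β • D₀.val) F := by
  have hh := two_mul_C_half
  constructor
  · intro a
    fin_cases a
    · simp only [T₀_val, Fin.zero_eta, Fin.sum_univ_two, Matrix.smul_apply, Matrix.of_apply,
        Matrix.cons_val_zero, Matrix.cons_val_one, Matrix.cons_val', Matrix.cons_val_fin_one,
        smul_eq_mul, C_mul, C_three_half]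
      linear_combination C (1 / 2) * h0 - subst T.val (F 0) * hh
    · simp only [T₀_val, Fin.mk_one, Fin.sum_univ_two, Matrix.smul_apply, Matrix.of_apply,
        Matrix.cons_val_zero, Matrix.cons_val_one, Matrix.cons_val', Matrix.cons_val_fin_one,
        smul_eq_mul, C_mul, C_neg_half]
      linear_combination C (1 / 2) * h1 - subst T.val (F 1) * hh
  · intro a
    fin_cases a
    · simp [h2, D₀_val]
    · simp [h3, D₀_val]

/-! ### Six basic covariants and their brackets -/

/-- The identity covariant. -/
noncomputable def vecId : Fin 2 → MvPolynomial (Fin 2) ℂ := ![X 0, X 1]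

/-- The skew gradient of `Γ`. -/
noncomputable def vecGam : Fin 2 → MvPolynomial (Fin 2) ℂ :=
  ![5 * X 0 * X 1 ^ 4 - X 0 ^ 5, 5 * X 0 ^ 4 * X 1 - X 1 ^ 5]

/-- The skew gradient of `x⁸ + 14x⁴y⁴ + y⁸`, divided by `8`. -/
noncomputable def vecTheta : Fin 2 → MvPolynomial (Fin 2) ℂ :=
  ![7 * X 0 ^ 4 * X 1 ^ 3 + X 1 ^ 7, -X 0 ^ 7 - 7 * X 0 ^ 3 * X 1 ^ 4]

/-- The skew gradient of `Δ`, divided by `12`. -/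
noncomputable def vecDel : Fin 2 → MvPolynomial (Fin 2) ℂ :=
  ![-11 * X 0 ^ 8 * X 1 ^ 3 - 22 * X 0 ^ 4 * X 1 ^ 7 + X 1 ^ 11,
    -X 0 ^ 11 + 22 * X 0 ^ 7 * X 1 ^ 4 + 11 * X 0 ^ 3 * X 1 ^ 8]

/-- The covariant `(x⁴ + y⁴, 2x²y²)`. -/
noncomputable def vecFour : Fin 2 → MvPolynomial (Fin 2) ℂ :=
  ![X 0 ^ 4 + X 1 ^ 4, 2 * X 0 ^ 2 * X 1 ^ 2]

/-- A covariant of degree 8. -/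
noncomputable def vecEight : Fin 2 → MvPolynomial (Fin 2) ℂ :=
  ![12 * X 0 ^ 6 * X 1 ^ 2 + 12 * X 0 ^ 2 * X 1 ^ 6, X 0 ^ 8 - 10 * X 0 ^ 4 * X 1 ^ 4 + X 1 ^ 8]

/-- The intertwiner `(a, b) ↦ (-3b, a)` between a two-dimensional representation of the symmetric
group on three letters and its product with the sign. -/
noncomputable def twistVec (F : Fin 2 → MvPolynomial (Fin 2) ℂ) : Fin 2 → MvPolynomial (Fin 2) ℂ :=
  ![-3 * F 1, F 0]

lemma isCovariant_vecId : IsCovariant ((1 : ℂ) • T.val) ((1 : ℂ) • D.val) vecId := by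
  refine isCovariant_nat ?_ ?_ ?_ ?_ <;>
    simp [vecId, subst_T_X0, subst_T_X1, subst_D_X0, subst_D_X1]

-- If f has character χ, its skew gradient (∂f/∂y, -∂f/∂x) transforms by χ·det⁻¹ times the natural
-- representation. This gives the types of `vecGam`, `vecTheta` and `vecDel`.
open Complex in
lemma isCovariant_vecGam : IsCovariant ((-1 : ℂ) • T.val) ((1 : ℂ) • D.val) vecGam := by
  have h5 : (C rt : MvPolynomial (Fin 2) ℂ) ^ 5 * 4 = C rt := by
    linear_combination C rt * (2 * C rt ^ 2 + 1) * C_rt_sq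
  have h4 := C_I_pow_four
  refine isCovariant_nat ?_ ?_ ?_ ?_ <;>
    simp only [vecGam, Matrix.cons_val_zero, Matrix.cons_val_one, Matrix.cons_val_fin_one, map_sub,
      map_mul, map_pow, map_ofNat, C_neg, subst_T_X0, subst_T_X1, subst_D_X0, subst_D_X1,
      C_1]
  · linear_combination (-1) * (5 * X 0 * X 1 ^ 4 - X 0 ^ 5 + 5 * X 0 ^ 4 * X 1 - X 1 ^ 5) * h5
  · linear_combination (-1) * (5 * X 0 * X 1 ^ 4 - X 0 ^ 5 - 5 * X 0 ^ 4 * X 1 + X 1 ^ 5) * h5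
  · linear_combination 5 * X 0 * X 1 ^ 4 * h4
  · linear_combination -X 1 ^ 5 * C I * h4

open Complex in
lemma isCovariant_vecTheta : IsCovariant ((-1 : ℂ) • T.val) ((-I) • D.val) vecTheta := by
  have h7 : (C rt : MvPolynomial (Fin 2) ℂ) ^ 7 * 8 = C rt := by
    linear_combination C rt * (4 * C rt ^ 4 + 2 * C rt ^ 2 + 1) * C_rt_sq
  have h2 := C_I_sq
  have h4 := C_I_pow_four
  refine isCovariant_nat ?_ ?_ ?_ ?_ <;>
    simp only [vecTheta, Matrix.cons_val_zero, Matrix.cons_val_one, Matrix.cons_val_fin_one,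
      map_add, map_sub, map_mul, map_pow, map_neg, map_ofNat, subst_T_X0, subst_T_X1, subst_D_X0,
      subst_D_X1, C_1]
  · linear_combination (-1) * (7 * X 0 ^ 4 * X 1 ^ 3 + X 1 ^ 7
      + (-X 0 ^ 7 - 7 * X 0 ^ 3 * X 1 ^ 4)) * h7
  · linear_combination (-1) * (7 * X 0 ^ 4 * X 1 ^ 3 + X 1 ^ 7
      - (-X 0 ^ 7 - 7 * X 0 ^ 3 * X 1 ^ 4)) * h7
  · linear_combination C I * (7 * X 0 ^ 4 * X 1 ^ 3 + X 1 ^ 7) * h2 + X 1 ^ 7 * C I ^ 3 * h4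
  · linear_combination (-X 0 ^ 7 - 7 * X 0 ^ 3 * X 1 ^ 4) * h2 - 7 * X 0 ^ 3 * X 1 ^ 4 * h4

open Complex in
lemma isCovariant_vecDel : IsCovariant ((1 : ℂ) • T.val) ((-I) • D.val) vecDel := by
  have h11 : (C rt : MvPolynomial (Fin 2) ℂ) ^ 11 * 32 = C rt := by
    linear_combination C rt * (16 * C rt ^ 8 + 8 * C rt ^ 6 + 4 * C rt ^ 4 + 2 * C rt ^ 2 + 1) *
      C_rt_sq
  have h2 := C_I_sq
  have h4 := C_I_pow_four
  refine isCovariant_nat ?_ ?_ ?_ ?_ <;>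
    simp only [vecDel, Matrix.cons_val_zero, Matrix.cons_val_one, Matrix.cons_val_fin_one,
      map_add, map_sub, map_mul, map_pow, map_neg, map_ofNat, subst_T_X0, subst_T_X1, subst_D_X0,
      subst_D_X1, C_1]
  · linear_combination (-11 * X 0 ^ 8 * X 1 ^ 3 - 22 * X 0 ^ 4 * X 1 ^ 7 + X 1 ^ 11
      + (-X 0 ^ 11 + 22 * X 0 ^ 7 * X 1 ^ 4 + 11 * X 0 ^ 3 * X 1 ^ 8)) * h11
  · linear_combination (-11 * X 0 ^ 8 * X 1 ^ 3 - 22 * X 0 ^ 4 * X 1 ^ 7 + X 1 ^ 11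
      - (-X 0 ^ 11 + 22 * X 0 ^ 7 * X 1 ^ 4 + 11 * X 0 ^ 3 * X 1 ^ 8)) * h11
  · linear_combination C I * (-11 * X 0 ^ 8 * X 1 ^ 3 - 22 * X 0 ^ 4 * X 1 ^ 7 + X 1 ^ 11) * h2 +
      (-22 * X 0 ^ 4 * X 1 ^ 7 * C I ^ 3 + X 1 ^ 11 * C I ^ 3 * (C I ^ 4 + 1)) * h4
  · linear_combination (-X 0 ^ 11 + 22 * X 0 ^ 7 * X 1 ^ 4 + 11 * X 0 ^ 3 * X 1 ^ 8) * h2 +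
      (22 * X 0 ^ 7 * X 1 ^ 4 + 11 * X 0 ^ 3 * X 1 ^ 8 * (C I ^ 4 + 1)) * h4

lemma isCovariant_vecFour : IsCovariant ((1 : ℂ) • T₀.val) ((1 : ℂ) • D₀.val) vecFour := by
  have h : (C rt : MvPolynomial (Fin 2) ℂ) ^ 4 * 4 = 1 := by
    linear_combination (2 * C rt ^ 2 + 1) * C_rt_sq
  have h2 := C_I_sq
  have h4 := C_I_pow_four
  refine isCovariant_zero ?_ ?_ ?_ ?_ <;>
    simp only [vecFour, Matrix.cons_val_zero, Matrix.cons_val_one, Matrix.cons_val_fin_one,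
      map_add, map_mul, map_pow, map_ofNat, subst_T_X0, subst_T_X1, subst_D_X0,
      subst_D_X1, C_1]
  · linear_combination (X 0 ^ 4 + X 1 ^ 4 + 6 * X 0 ^ 2 * X 1 ^ 2) * h
  · linear_combination (X 0 ^ 4 + X 1 ^ 4 - 2 * X 0 ^ 2 * X 1 ^ 2) * h
  · linear_combination X 1 ^ 4 * h4
  · linear_combination 2 * X 0 ^ 2 * X 1 ^ 2 * h2

lemma isCovariant_vecEight : IsCovariant ((1 : ℂ) • T₀.val) ((-1 : ℂ) • D₀.val) vecEight := by
  have h : (C rt : MvPolynomial (Fin 2) ℂ) ^ 8 * 16 = 1 := by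
    linear_combination (8 * C rt ^ 6 + 4 * C rt ^ 4 + 2 * C rt ^ 2 + 1) * C_rt_sq
  have h2 := C_I_sq
  have h4 := C_I_pow_four
  refine isCovariant_zero ?_ ?_ ?_ ?_ <;>
    simp only [vecEight, Matrix.cons_val_zero, Matrix.cons_val_one, Matrix.cons_val_fin_one,
      map_add, map_sub, map_mul, map_pow, map_neg, map_ofNat, subst_T_X0, subst_T_X1, subst_D_X0,
      subst_D_X1, C_1]
  · linear_combination (12 * X 0 ^ 6 * X 1 ^ 2 + 12 * X 0 ^ 2 * X 1 ^ 6 +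
      3 * (X 0 ^ 8 - 10 * X 0 ^ 4 * X 1 ^ 4 + X 1 ^ 8)) * h
  · linear_combination (12 * X 0 ^ 6 * X 1 ^ 2 + 12 * X 0 ^ 2 * X 1 ^ 6 -
      (X 0 ^ 8 - 10 * X 0 ^ 4 * X 1 ^ 4 + X 1 ^ 8)) * h
  · linear_combination (12 * X 0 ^ 6 * X 1 ^ 2 + 12 * X 0 ^ 2 * X 1 ^ 6) * h2 +
      12 * X 0 ^ 2 * X 1 ^ 6 * C Complex.I ^ 2 * h4
  · linear_combination (-10 * X 0 ^ 4 * X 1 ^ 4 + X 1 ^ 8 * (C Complex.I ^ 4 + 1)) * h4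

/-- The intertwiner reverses both signs. As `vecFour` and `vecEight` agree under T and are opposite
under D, twisting one of them yields the pair needed: opposite under T, equal under D. -/
lemma isCovariant_twistVec {ε β : ℂ} {F : Fin 2 → MvPolynomial (Fin 2) ℂ}
    (h : IsCovariant (ε • T₀.val) (β • D₀.val) F) :
    IsCovariant ((-ε) • T₀.val) ((-β) • D₀.val) (twistVec F) := by
  have hh := two_mul_C_half
  have h0 := h.subst_T 0
  have h1 := h.subst_T 1
  have h2 := h.subst_D 0
  have h3 := h.subst_D 1
  simp only [T₀_val, D₀_val, Fin.sum_univ_two, Matrix.smul_apply, Matrix.of_apply,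
    Matrix.cons_val_zero, Matrix.cons_val_one, Matrix.cons_val', Matrix.cons_val_fin_one,
    smul_eq_mul, C_mul, C_three_half, C_neg_half, C_0, C_1, C_neg] at h0 h1 h2 h3
  refine isCovariant_zero ?_ ?_ ?_ ?_ <;>
    simp only [twistVec, Matrix.cons_val_zero, Matrix.cons_val_one, Matrix.cons_val_fin_one,
      map_mul, map_neg, map_ofNat]
  · linear_combination (-6) * h1 - 3 * C ε * (F 0 - F 1) * hh
  · linear_combination 2 * h0 + C ε * (F 0 + 3 * F 1) * hh
  · linear_combination (-3) * h3
  · linear_combination h2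

/-- For an explicit polynomial this turns homogeneity into an identity that `ring` decides. -/
lemma isHomogeneous_of_scaling {f : MvPolynomial (Fin 2) ℂ} {d : ℕ}
    (h : subst (Matrix.diagonal fun _ => 2) f = 2 ^ d * f) : f.IsHomogeneous d := by
  have h1 := (isHomogeneous_mul_iff (a := f) (d := d) (isHomogeneous_one (Fin 2) ℂ) one_ne_zero).2
    (isHomogeneous_of_subst_two (by rw [h, pow_zero, C_1, one_mul, C_pow, map_ofNat]))
  rwa [one_mul] at h1

lemma subst_two_X (j : Fin 2) :
    subst (Matrix.diagonal fun _ => (2 : ℂ)) (X j) = (2 : MvPolynomial (Fin 2) ℂ) * X j := by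
  rw [subst_two_of_isHomogeneous (isHomogeneous_X ℂ j), pow_one, map_ofNat]

lemma isHomogeneousVec_vecId : IsHomogeneousVec vecId 1 := fun j => by
  fin_cases j
  · exact isHomogeneous_X ℂ 0
  · exact isHomogeneous_X ℂ 1

lemma isHomogeneousVec_vecGam : IsHomogeneousVec vecGam 5 := fun j => by
  refine isHomogeneous_of_scaling ?_
  fin_cases j <;> simp only [vecGam, Fin.zero_eta, Fin.mk_one, Matrix.cons_val_zero,
    Matrix.cons_val_one, Matrix.cons_val_fin_one, map_sub, map_mul, map_pow,
    map_ofNat, subst_two_X] <;> ring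

lemma isHomogeneousVec_vecTheta : IsHomogeneousVec vecTheta 7 := fun j => by
  refine isHomogeneous_of_scaling ?_
  fin_cases j <;> simp only [vecTheta, Fin.zero_eta, Fin.mk_one, Matrix.cons_val_zero,
    Matrix.cons_val_one, Matrix.cons_val_fin_one, map_add, map_sub, map_neg, map_mul, map_pow,
    map_ofNat, subst_two_X] <;> ring

lemma isHomogeneousVec_vecDel : IsHomogeneousVec vecDel 11 := fun j => by
  refine isHomogeneous_of_scaling ?_
  fin_cases j <;> simp only [vecDel, Fin.zero_eta, Fin.mk_one, Matrix.cons_val_zero,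
    Matrix.cons_val_one, Matrix.cons_val_fin_one, map_add, map_sub, map_neg, map_mul, map_pow,
    map_ofNat, subst_two_X] <;> ring

lemma isHomogeneousVec_vecFour : IsHomogeneousVec vecFour 4 := fun j => by
  refine isHomogeneous_of_scaling ?_
  fin_cases j <;> simp only [vecFour, Fin.zero_eta, Fin.mk_one, Matrix.cons_val_zero,
    Matrix.cons_val_one, Matrix.cons_val_fin_one, map_add, map_mul, map_pow,
    map_ofNat, subst_two_X] <;> ring

lemma isHomogeneousVec_vecEight : IsHomogeneousVec vecEight 8 := fun j => by
  refine isHomogeneous_of_scaling ?_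
  fin_cases j <;> simp only [vecEight, Fin.zero_eta, Fin.mk_one, Matrix.cons_val_zero,
    Matrix.cons_val_one, Matrix.cons_val_fin_one, map_add, map_sub, map_mul, map_pow,
    map_ofNat, subst_two_X] <;> ring

lemma isHomogeneousVec_twistVec {F : Fin 2 → MvPolynomial (Fin 2) ℂ} {d : ℕ}
    (hF : IsHomogeneousVec F d) : IsHomogeneousVec (twistVec F) d := fun j => by
  have h := (hF 1).C_mul (-3)
  fin_cases j
  · rw [C_neg, map_ofNat] at h
    exact h
  · exact hF 0

/-- Euler's identity for Γ, of degree 6. -/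
lemma bracket_vecId_vecGam : bracket vecId vecGam = C (-6) * Gam ^ 1 := by
  simp only [bracket, vecId, vecGam, Gam, Matrix.cons_val_zero, Matrix.cons_val_one,
    Matrix.cons_val_fin_one, C_neg, map_ofNat]
  ring

lemma bracket_vecGam_vecId : bracket vecGam vecId = C 6 * Gam ^ 1 := by
  simp only [bracket, vecId, vecGam, Gam, Matrix.cons_val_zero, Matrix.cons_val_one,
    Matrix.cons_val_fin_one, map_ofNat]
  ring

/-- Up to the factor 1/96 this is the Jacobian of Δ and `theta`. -/
lemma bracket_vecDel_vecTheta : bracket vecDel vecTheta = C (-18) * Gam ^ 3 := by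
  simp only [bracket, vecDel, vecTheta, Gam, Matrix.cons_val_zero, Matrix.cons_val_one,
    Matrix.cons_val_fin_one, C_neg, map_ofNat]
  ring

lemma bracket_vecTheta_vecDel : bracket vecTheta vecDel = C 18 * Gam ^ 3 := by
  simp only [bracket, vecDel, vecTheta, Gam, Matrix.cons_val_zero, Matrix.cons_val_one,
    Matrix.cons_val_fin_one, map_ofNat]
  ring

/-- Bracketing with a twisted vector is the symmetric form aa' + 3bb', which T₀ and D₀ preserve;
hence the same value with the roles exchanged. -/
lemma bracket_vecEight_twistVec_vecFour :
    bracket vecEight (twistVec vecFour) = C 18 * Gam ^ 2 := by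
  simp only [bracket, vecEight, vecFour, twistVec, Gam, Matrix.cons_val_zero, Matrix.cons_val_one,
    Matrix.cons_val_fin_one, map_ofNat]
  ring

lemma bracket_vecFour_twistVec_vecEight :
    bracket vecFour (twistVec vecEight) = C 18 * Gam ^ 2 := by
  simp only [bracket, vecEight, vecFour, twistVec, Gam, Matrix.cons_val_zero, Matrix.cons_val_one,
    Matrix.cons_val_fin_one, map_ofNat]
  ring

/-- The first generator, up to Γ^m, is `vecId` for 9, 10, 11, `vecDel` for 12, `vecGam` for 13, 14,
15, `vecTheta` for 16, `vecEight` for 17, 20 and `vecFour` for 18, 19. -/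
lemma exists_generators {i : ℕ} (hi : 9 ≤ i) (hi' : i ≤ 20) :
    ∃ u v, u ∈ covariants (rho i) ∧ v ∈ covariants (rho i) ∧ IsHomogeneousVec u (deg₁ i) ∧
      IsHomogeneousVec v (deg₂ i) ∧
      bracket u v = C (cConst i : ℂ) * Del * Gam ^ kExp i := by
  have hI2 := Complex.I_mul_I
  have h2 := Complex.I_sq
  have k0 := @exists_generators_of_isCovariant i
  have kId := fun m => k0 (m := m) isCovariant_vecId isCovariant_vecGam isHomogeneousVec_vecId
    isHomogeneousVec_vecGam bracket_vecId_vecGam (by norm_num)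
  have kGam := fun m => k0 (m := m) isCovariant_vecGam isCovariant_vecId isHomogeneousVec_vecGam
    isHomogeneousVec_vecId bracket_vecGam_vecId (by norm_num)
  have kDel := fun m => k0 (m := m) isCovariant_vecDel isCovariant_vecTheta
    isHomogeneousVec_vecDel isHomogeneousVec_vecTheta bracket_vecDel_vecTheta (by norm_num)
  have kTheta := fun m => k0 (m := m) isCovariant_vecTheta isCovariant_vecDel
    isHomogeneousVec_vecTheta isHomogeneousVec_vecDel bracket_vecTheta_vecDel (by norm_num)
  have kEight := fun m => k0 (m := m) isCovariant_vecEight (isCovariant_twistVec isCovariant_vecFour)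
    isHomogeneousVec_vecEight (isHomogeneousVec_twistVec isHomogeneousVec_vecFour)
    bracket_vecEight_twistVec_vecFour (by norm_num)
  have kFour := fun m => k0 (m := m) isCovariant_vecFour (isCovariant_twistVec isCovariant_vecEight)
    isHomogeneousVec_vecFour (isHomogeneousVec_twistVec isHomogeneousVec_vecEight)
    bracket_vecFour_twistVec_vecEight (by norm_num)
  clear k0
  interval_cases i
  · apply kId 0 <;> simp [rhoT, rhoD, deg₁, deg₂, kExp, D_val]
  · apply kId 1 <;> simp [rhoT, rhoD, deg₁, deg₂, kExp, D_val, hI2]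
  · apply kId 2 <;> simp [rhoT, rhoD, deg₁, deg₂, kExp, D_val, h2]
  · apply kDel 0 <;> simp [rhoT, rhoD, deg₁, deg₂, kExp, D_val, hI2]
  · apply kGam 0 <;> simp [rhoT, rhoD, deg₁, deg₂, kExp, D_val]
  · apply kGam 1 <;> simp [rhoT, rhoD, deg₁, deg₂, kExp, D_val, hI2]
  · apply kGam 2 <;> simp [rhoT, rhoD, deg₁, deg₂, kExp, D_val, h2]
  · apply kTheta 0 <;> simp [rhoT, rhoD, deg₁, deg₂, kExp, D_val, hI2]
  · apply kEight 0 <;> simp [rhoT, rhoD, deg₁, deg₂, kExp, T₀_val, D₀_val]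
  · apply kFour 1 <;> simp [rhoT, rhoD, deg₁, deg₂, kExp, T₀_val, D₀_val]
  · apply kFour 0 <;> simp [rhoT, rhoD, deg₁, deg₂, kExp, T₀_val, D₀_val]
  · apply kEight 1 <;> simp [rhoT, rhoD, deg₁, deg₂, kExp, T₀_val, D₀_val]

/-- The expansions listed in `seriesCoeff`, multiplied by the denominator. -/
lemma expansion_mul {i : ℕ} (hi : 9 ≤ i) (hi' : i ≤ 20) : ∃ Q : PowerSeries ℤ,
    (∑ j : Fin 5, PowerSeries.C (seriesCoeff i j : ℤ) *
      PowerSeries.X ^ (deg₁ i + 8 * (j : ℕ))) *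
        ((1 - PowerSeries.X ^ 8) * (1 - PowerSeries.X ^ 24)) =
      PowerSeries.X ^ deg₁ i + PowerSeries.X ^ deg₂ i + PowerSeries.X ^ (deg₁ i + 40) * Q := by
  have h : (deg₂ i = deg₁ i + 16 ∧ seriesCoeff i = ![1, 1, 2, 3, 3]) ∨
      (deg₂ i = deg₁ i + 8 ∧ seriesCoeff i = ![1, 2, 2, 3, 4]) := by
    interval_cases i <;> simp [deg₁, deg₂, seriesCoeff]
  obtain ⟨h1, h2⟩ | ⟨h1, h2⟩ := h
  -- With s = t⁸: (1 + s + 2s² + 3s³ + 3s⁴)(1 - s)(1 - s³) = 1 + s² + s⁵(-4 - s + 3s³). The other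
  -- case is similar.
  · refine ⟨-4 - PowerSeries.X ^ 8 + 3 * PowerSeries.X ^ 24, ?_⟩
    rw [h1, h2]
    simp [Fin.sum_univ_five]
    ring
  · refine ⟨-4 - PowerSeries.X ^ 8 - PowerSeries.X ^ 16 + 4 * PowerSeries.X ^ 24, ?_⟩
    rw [h1, h2]
    simp [Fin.sum_univ_five]
    ring

end G9

/-! ### The theorem -/

theorem mainTheorem3 (i : ℕ) (hi : 9 ≤ i) (hi' : i ≤ 20) :
    Module.Free (G9.invariants G9.group) (G9.covariants (G9.rho i)) ∧
    Module.finrank (G9.invariants G9.group) (G9.covariants (G9.rho i)) = 2 ∧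
    (∃ u : Module.Basis (Fin 2) (G9.invariants G9.group) (G9.covariants (G9.rho i)),
      G9.IsHomogeneousVec (u 0 : Fin 2 → MvPolynomial (Fin 2) ℂ) (G9.deg₁ i) ∧
      G9.IsHomogeneousVec (u 1 : Fin 2 → MvPolynomial (Fin 2) ℂ) (G9.deg₂ i) ∧
      Matrix.det (Matrix.of fun a b => (u b : Fin 2 → MvPolynomial (Fin 2) ℂ) a) =
        MvPolynomial.C (G9.cConst i : ℂ) * G9.Del * G9.Gam ^ G9.kExp i) ∧
    G9.deg₁ i + G9.deg₂ i = G9.Del.totalDegree + G9.kExp i * G9.Gam.totalDegree ∧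
    G9.deg₁ i + G9.deg₂ i = 12 + 6 * G9.kExp i ∧
    G9.hilbertSeries (G9.rho i) * ((1 - PowerSeries.X ^ 8) * (1 - PowerSeries.X ^ 24)) =
      PowerSeries.X ^ G9.deg₁ i + PowerSeries.X ^ G9.deg₂ i ∧
    (∀ d < G9.deg₁ i + 40,
      PowerSeries.coeff d (G9.hilbertSeries (G9.rho i)) =
        PowerSeries.coeff d (∑ j : Fin 5,
          PowerSeries.C (G9.seriesCoeff i j : ℤ) *
            PowerSeries.X ^ (G9.deg₁ i + 8 * (j : ℕ)))) := by
  obtain ⟨u, v, hu, hv, hud, hvd, h⟩ := G9.exists_generators hi hi'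
  have hc : (G9.cConst i : ℂ) ≠ 0 := by
    interval_cases i <;> simp [G9.cConst]
  obtain ⟨B, hB0, hB1⟩ := G9.exists_basis hi hi' hc hu hv h
  have hs := G9.hilbertSeries_mul hi hi' hc hu hv hud hvd h
  have hdeg : G9.deg₁ i + G9.deg₂ i = 12 + 6 * G9.kExp i := by
    interval_cases i <;> rfl
  refine ⟨Module.Free.of_basis B, ?_, ⟨B, ?_, ?_, ?_⟩, ?_, hdeg, hs, ?_⟩
  · rw [Module.finrank_eq_card_basis B, Fintype.card_fin]
  · rw [hB0]
    exact hud
  · rw [hB1]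
    exact hvd
  · rw [Matrix.det_fin_two]
    simp only [Matrix.of_apply, hB0, hB1]
    rw [← h, G9.bracket, mul_comm (u 1)]
  · rw [G9.isHomogeneous_Del.totalDegree G9.Del_ne_zero,
      G9.isHomogeneous_Gam.totalDegree G9.Gam_ne_zero, hdeg, mul_comm 6]
  · intro d hd
    obtain ⟨Q, hQ⟩ := G9.expansion_mul hi hi'
    exact G9.coeff_eq_of_mul_eq hs hQ hd
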